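/- **Setting.** Let $X$ be a surface homeomorphic to the plane, $\pi:X\to\overline{\mathbf C}$ a local homeomorphism, and $A\subset\overline{\mathbf C}$ a finite set, invariant under complex conjugation (its elements are called base points), such that $\pi:X\setminus\pi^{-1}(A)\to\overline{\mathbf C}\setminus A$ is a covering. Fix pairwise disjoint open round discs $D_a$ centered at the points $a\in A$. A component $V$ of $\pi^{-1}(D_a\setminus\{a\})$ on which $\pi$ has infinite degree is called a logarithmic singularity over $a$; suppose that there are only finitely many of them. Let $s:X\to X$ be a homeomorphism with $s\circ s=\mathrm{id}$ and $\pi(s(x))=\overline{\pi(x)}$. Then $(X,\pi,s)$ is a symmetric N-surface; its axis is the set of fixed points of $s$. A logarithmic singularity $V$ over a real base point $a\in\mathbf R\cup\{\infty\}$ is called real if $s(V)=V$. An associated real Nevanlinna function is a real meromorphic function $f=\pi\circ\phi$ in $\mathbf C$, where $\phi:\mathbf C\to X$ is a homeomorphism such that $\pi\circ\phi$ is meromorphic and $\phi(\overline z)=s(\phi(z))$. **Symmetric Speiser graph.** If more than two base points are real, choose two real base points such that all real logarithmic singularities lie over these two points, and let $M$ be the set of all other real base points; if at most two base points are real, let $M=\emptyset$.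 For $a\in M$ choose $\varepsilon_a>0$ with $a+i\varepsilon_a\in D_a$ (for $a=\infty$ this point is read in the chart $-1/z$) and a homeomorphism $\eta_a$ of $\overline{\mathbf C}$ which is the identity outside $D_a$ and sends $a$ to $a+i\varepsilon_a$. Let $H$ be one of the two components of the complement of the axis. Define $\pi^*$ by $\pi^*(x)=\eta_a(\pi(x))$ if $x$ belongs to a logarithmic singularity $V\subset H$ over some $a\in M$, by $\pi^*(x)=\overline{\eta_a(\overline{\pi(x)})}$ if $x$ belongs to a logarithmic singularity $V\subset s(H)$ over some $a\in M$, and by $\pi^*(x)=\pi(x)$ otherwise. The new base points are the points of $A\setminus M$ and the points $a\pm i\varepsilon_a$, $a\in M$; the latter stand for labels $a^{\pm}$. Let $\Gamma\subset\overline{\mathbf C}$ be a Jordan curve through the new base points, symmetric with respect to complex conjugation. Choose points $\times,\circ\in\mathbf R\cup\{\infty\}$ in different components of $\overline{\mathbf C}\setminus\Gamma$, and simple arcs from $\times$ to $\circ$, disjoint except for their endpoints, exactly one for each open arc of $\Gamma$ between consecutive new base points, so that each of these simple arcs meets $\Gamma$ in exactly one point, which belongs to the corresponding arc of $\Gamma$,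 and so that the union $L$ of the simple arcs is symmetric. Then $S=(\pi^*)^{-1}(L)$ is a symmetric Speiser graph of $(X,\pi,s)$. Its vertices are the preimages of $\times$ and $\circ$, its edges are the components of the preimage of $L\setminus\{\times,\circ\}$, and its faces are the components of $X\setminus S$. A face is labeled by the new base point $b$ if $\pi^*$ maps it to the component of $\overline{\mathbf C}\setminus L$ that contains $b$. A face is bounded if its boundary consists of finitely many edges and vertices, and otherwise unbounded. Let $T(S)$ be the graph obtained from $S$ by replacing multiple edges by single ones; logarithmic ends of $S$ are the maximal (by inclusion) infinite one-sided branches of $T(S)$ all of whose vertices have degree $2$ in $T(S)$. **Proposition 3.** Let $S$ be a symmetric Speiser graph of a symmetric N-surface $(X,\pi,s)$, and let $f$ be an associated real Nevanlinna function. Assume that the number of logarithmic ends is at least $3$, that $0$ is a base point, that there is at most one real logarithmic singularity which does not lie over $0$, and that $S$ does not have labels $0^+$ or $0^-$ (that is, $0\notin M$). Then all zeros of $f$ are real if and only if each vertex of $S$ belongs either to the axis or to the boundary of an unbounded face labeled by $0$. -/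

import Mathlib

open scoped OnePoint

noncomputable section

namespace NSurface

/-! ### The Riemann sphere -/

/-- The Riemann sphere. -/
abbrev Sphere : Type := OnePoint ℂ

/-- Complex conjugation on the Riemann sphere (it fixes `∞`). -/
def conj : Sphere → Sphere := OnePoint.map (starRingEnd ℂ)

/-- The open round disc of radius `r` about `a`; for `a = ∞` it is `{|z| > 1/r} ∪ {∞}`. -/
def disc (a : Sphere) (r : ℝ) : Set Sphere :=
  a.elim ((fun z : ℂ => (z : Sphere)) '' Metric.closedBall 0 r⁻¹)ᶜ
    (fun z => (fun w : ℂ => (w : Sphere)) '' Metric.ball z r)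

/-- The point `a + iε`; at `a = ∞` this is read in the chart `w = -1/z`, which preserves the upper
half-plane, so that it is the point `i/ε`. -/
def shift (a : Sphere) (ε : ℝ) : Sphere :=
  a.elim ((Complex.I / (ε : ℂ) : ℂ) : Sphere) (fun z => ((z + (ε : ℂ) * Complex.I : ℂ) : Sphere))

/-- `C` is a connected component of the subset `T`. -/
def IsComponentOf {Y : Type*} [TopologicalSpace Y] (T C : Set Y) : Prop :=
  ∃ x ∈ T, C = connectedComponentIn T x

/-! ### Logarithmic singularities and N-surfaces -/

section Surfaces

variable {X : Type*} [TopologicalSpace X]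

/-- `V` defines a logarithmic singularity over `a`, as seen in the disc of radius `r` about `a`:
`V` is a component of the preimage of the punctured disc, of infinite degree over it. -/
def IsLogSingularity (π : X → Sphere) (a : Sphere) (r : ℝ) (V : Set X) : Prop :=
  IsComponentOf (π ⁻¹' (disc a r \ {a})) V ∧
    ∃ y ∈ disc a r \ {a}, (V ∩ π ⁻¹' {y}).Infinite

/-- `(X, π)` is an N-surface with set of base points `A`. -/
structure IsNSurface (A : Set Sphere) (π : X → Sphere) : Prop where
  /-- `X` is an open simply connected surface, that is, homeomorphic to the plane. -/
  plane : Nonempty (X ≃ₜ ℂ)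
  isLocalHomeomorph : IsLocalHomeomorph π
  finite_base : A.Finite
  isCoveringMapOn : IsCoveringMapOn π Aᶜ
  finite_log : ∀ a ∈ A, ∀ r > 0, disc a r ∩ A = {a} → {V | IsLogSingularity π a r V}.Finite

/-- `(X, π, s)` is a symmetric N-surface with (conjugation invariant) set of base points `A`. -/
structure IsSymmetricNSurface (A : Set Sphere) (π : X → Sphere) (s : X → X) : Prop
    extends IsNSurface A π where
  continuous_inv : Continuous s
  involutive : Function.Involutive s
  map_inv : ∀ x, π (s x) = conj (π x)
  conj_base : ∀ a ∈ A, conj a ∈ A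

/-- The axis of symmetry. -/
def axis (s : X → X) : Set X := {x | s x = x}

/-- The real base points. -/
def realBase (A : Set Sphere) : Set Sphere := {a ∈ A | conj a = a}

/-- A choice of disjoint round discs about the base points; in particular each of them contains
exactly one base point. -/
structure DiscSystem (A : Set Sphere) where
  radius : Sphere → ℝ
  radius_pos : ∀ a ∈ A, 0 < radius a
  disjoint : A.PairwiseDisjoint fun a => disc a (radius a)

/-- The real logarithmic singularities, as pairs of a real base point `a` and a region `V` over
the disc about `a` with `s(V) = V`. -/
def realLogSingularities {A : Set Sphere} (π : X → Sphere) (s : X → X) (D : DiscSystem A) :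
    Set (Sphere × Set X) :=
  {p | p.1 ∈ realBase A ∧ IsLogSingularity π p.1 (D.radius p.1) p.2 ∧ s '' p.2 = p.2}

end Surfaces

/-! ### Moving real base points off the real line -/

/-- The symmetric deformation of a symmetric N-surface that replaces real base points `a`, over
which there are no real logarithmic singularities, by pairs `a ± iε` of nonreal base points. All
real base points but two are moved (none, if there are at most two). -/
structure Deformation {X : Type*} [TopologicalSpace X] {A : Set Sphere} (π : X → Sphere)
    (s : X → X) (D : DiscSystem A) where
  /-- The set of the real base points that are moved. -/
  moved : Set Sphere
  moved_subset : moved ⊆ realBase A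
  ncard_kept : (realBase A \ moved).ncard = min 2 (realBase A).ncard
  not_real : ∀ p ∈ realLogSingularities π s D, p.1 ∉ moved
  /-- One of the two halfplanes into which the axis divides the surface. -/
  half : Set X
  half_spec : IsComponentOf (axis s)ᶜ half
  ε : Sphere → ℝ
  ε_pos : ∀ a ∈ moved, 0 < ε a
  shift_mem : ∀ a ∈ moved, shift a (ε a) ∈ disc a (D.radius a)
  /-- The homeomorphism that moves `a` to `a + iε` and is the identity outside the disc. -/
  η : Sphere → Sphere ≃ₜ Sphere
  η_off : ∀ a ∈ moved, ∀ y ∉ disc a (D.radius a), η a y = y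
  η_base : ∀ a ∈ moved, η a a = shift a (ε a)
  /-- The deformed map. -/
  map : X → Sphere
  map_plus : ∀ a ∈ moved, ∀ V, IsLogSingularity π a (D.radius a) V → V ⊆ half →
    ∀ x ∈ V, map x = η a (π x)
  map_minus : ∀ a ∈ moved, ∀ V, IsLogSingularity π a (D.radius a) V → V ⊆ s '' half →
    ∀ x ∈ V, map x = conj (η a (conj (π x)))
  map_otherwise : ∀ x, (∀ a ∈ moved, ∀ V, IsLogSingularity π a (D.radius a) V → x ∉ V) →
    map x = π x

/-- The base points of the deformed surface: an unmoved `a` is its own label, and the points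
`a + iε` and `a - iε` stand for the labels `a⁺` and `a⁻` of a moved point `a`. -/
def Deformation.base {X : Type*} [TopologicalSpace X] {A : Set Sphere} {π : X → Sphere}
    {s : X → X} {D : DiscSystem A} (E : Deformation π s D) : Set Sphere :=
  (A \ E.moved) ∪ {b | ∃ a ∈ E.moved, b = shift a (E.ε a) ∨ b = conj (shift a (E.ε a))}

/-! ### The graph on the sphere -/

/-- The unit vector of angle `θ`, as a point of the sphere. -/
def unitPt (θ : ℝ) : Sphere := ((Complex.exp ((θ : ℂ) * Complex.I) : ℂ) : Sphere)

/-- The open ray of angle `θ` from `0` to `∞`. -/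
def openRay (θ : ℝ) : Set Sphere :=
  {y | ∃ t : ℝ, 0 < t ∧ y = (((t : ℂ) * Complex.exp ((θ : ℂ) * Complex.I) : ℂ) : Sphere)}

/-- A symmetric base curve through the points of `B`, together with a symmetric graph `L` that has
two vertices `×` and `∘`, on the real circle and on different sides of the curve, and disjoint
simple arcs `L_j` between them, one for each pair of consecutive points of `B`, such that `L_j`
crosses the curve at exactly one point, which lies between these two points.

By the Schoenflies theorem every such configuration is the image of a standard one under a
homeomorphism `h` of the sphere that commutes with complex conjugation; in the standard one, the
curve is the unit circle, `×` is `0`, `∘` is `∞`, and the arcs are the radial rays. -/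
structure SymmetricBaseGraph (B : Set Sphere) where
  h : Sphere ≃ₜ Sphere
  h_conj : ∀ y, h (conj y) = conj (h y)
  /-- The number of base points. -/
  q : ℕ
  /-- The angles of the base points, in their cyclic order. -/
  α : Fin (q + 1) → ℝ
  α_strictMono : StrictMono α
  α_last : α (Fin.last q) = α 0 + 2 * Real.pi
  /-- The angles of the arcs. -/
  β : Fin q → ℝ
  β_mem : ∀ j, β j ∈ Set.Ioo (α j.castSucc) (α j.succ)
  base_eq : Set.range (fun j : Fin q => h (unitPt (α j.castSucc))) = B
  /-- The union of the arcs is symmetric. -/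
  symm : conj '' (⋃ j, h '' openRay (β j)) = ⋃ j, h '' openRay (β j)

namespace SymmetricBaseGraph

variable {B : Set Sphere} (G : SymmetricBaseGraph B)

/-- The base curve. -/
def curve : Set Sphere := Set.range fun θ : ℝ => G.h (unitPt θ)

/-- The vertex `×`. -/
def cross : Sphere := G.h ((0 : ℂ) : Sphere)

/-- The vertex `∘`. -/
def circ : Sphere := G.h ∞

/-- The union of the open edges. -/
def openEdges : Set Sphere := ⋃ j, G.h '' openRay (G.β j)

/-- The embedded graph `L`. -/
def graph : Set Sphere := {G.cross, G.circ} ∪ G.openEdges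

end SymmetricBaseGraph

/-! ### Symmetric Speiser graphs -/

/-- A symmetric Speiser graph of the symmetric N-surface `(X, π, s)`: it is the preimage of a
symmetric graph on the sphere under a symmetric deformation of `π`. -/
structure SymmetricSpeiserGraph {X : Type*} [TopologicalSpace X] {A : Set Sphere} (π : X → Sphere)
    (s : X → X) (D : DiscSystem A) where
  deformation : Deformation π s D
  baseGraph : SymmetricBaseGraph deformation.base

namespace SymmetricSpeiserGraph

variable {X : Type*} [TopologicalSpace X] {A : Set Sphere} {π : X → Sphere} {s : X → X}
  {D : DiscSystem A} (S : SymmetricSpeiserGraph π s D)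

/-- The Speiser graph as a subset of the surface. -/
def carrier : Set X := S.deformation.map ⁻¹' S.baseGraph.graph

/-- The vertices. -/
def vertices : Set X := S.deformation.map ⁻¹' {S.baseGraph.cross, S.baseGraph.circ}

/-- `e` is an (open) edge. -/
def IsEdge (e : Set X) : Prop := IsComponentOf (S.deformation.map ⁻¹' S.baseGraph.openEdges) e

/-- `F` is a face. -/
def IsFace (F : Set X) : Prop := IsComponentOf S.carrierᶜ F

/-- The face `F` is bounded: its boundary consists of finitely many edges and vertices. -/
def IsBounded (F : Set X) : Prop :=
  {e | S.IsEdge e ∧ e ⊆ frontier F}.Finite ∧ (S.vertices ∩ frontier F).Finite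

/-- The set `F` (a face) is labeled by `b`: it lies over the face of the graph on the sphere that
contains `b`. -/
def HasLabel (F : Set X) (b : Sphere) : Prop :=
  b ∈ S.deformation.base ∧
    S.deformation.map '' F ⊆ connectedComponentIn S.baseGraph.graphᶜ b

/-- The tree `T(S)`: vertices are joined by a single edge if they are joined by at least one edge
of the Speiser graph. -/
def tree : SimpleGraph S.vertices where
  Adj v w := v ≠ w ∧ ∃ e, S.IsEdge e ∧ (v : X) ∈ closure e ∧ (w : X) ∈ closure e
  symm := ⟨fun _ _ h => ⟨h.1.symm, h.2.imp fun _ he => ⟨he.1, he.2.2, he.2.1⟩⟩⟩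
  loopless := ⟨fun _ h => h.1 rfl⟩

/-- The (vertex set of an) infinite branch of the tree, all of whose vertices have degree two. -/
def IsBranch (b : Set S.vertices) : Prop :=
  ∃ u : ℕ → S.vertices, Function.Injective u ∧ (∀ n, S.tree.Adj (u n) (u (n + 1))) ∧
    (∀ n, (S.tree.neighborSet (u n)).ncard = 2) ∧ b = Set.range u

/-- The logarithmic ends: the maximal branches. -/
def logEnds : Set (Set S.vertices) := {b | Maximal S.IsBranch b}

end SymmetricSpeiserGraph

/-! ### The associated function -/

/-- The map to the sphere given by a meromorphic function. -/
def toSphere (f : ℂ → ℂ) (z : ℂ) : Sphere :=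
  open Classical in if meromorphicOrderAt f z < 0 then ∞ else (f z : Sphere)

/-- `f` is a real function associated with the symmetric surface `(X, π, s)`: it is meromorphic in
the plane and `f = π ∘ φ` for a uniformizing homeomorphism `φ : ℂ → X` with `φ(z̄) = s(φ(z))`. The
map `φ` is conformal for the pulled back complex structure on `X` because `π ∘ φ` is meromorphic. -/
def IsAssociatedFunction {X : Type*} [TopologicalSpace X] (π : X → Sphere) (s : X → X)
    (f : ℂ → ℂ) : Prop :=
  MeromorphicOn f Set.univ ∧ ∃ φ : ℂ ≃ₜ X,
    (∀ z, φ (starRingEnd ℂ z) = s (φ z)) ∧ ∀ z, π (φ z) = toSphere f z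

end NSurface

end

/-
The deformed map π* is again a local homeomorphism of the plane into the sphere, it is a covering
over the complement of the new base points and symmetric, and it has the same preimages of 0 as π.
So the zeros of f correspond to the points of X that π* maps to 0.

A face over a component Ω of the complement of L containing one base point b is either mapped
homeomorphically onto Ω, or contains no point over b. If it has finitely many vertices, it has
finite degree over Ω \ {b}; if moreover it contained no point over b, it would be a neighbourhood
of infinity, and S would have finitely many vertices.

If all points over 0 are on the axis and v is a vertex on a face F labelled 0 with finitely many
vertices, then F contains a fixed point of s, so s(F) = F. Since F has only one vertex of either
kind, s fixes v. Conversely, the face F around a point x over 0 is bounded; of the faces labelled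
0, only F contains its ×-vertex v in its closure. So v is on no unbounded face labelled 0, hence on
the axis, whence s(F) = F, and s fixes x because π* is injective on F.
-/

section

open Set Filter Topology

namespace NSurface

section Components

variable {Y : Type*} [TopologicalSpace Y] {T C C' : Set Y} {x : Y}

theorem connectedComponentIn_eq_of_isOpen {S : Set Y} (hS : IsPreconnected S) (ho : IsOpen S)
    (hx : x ∈ S) (hST : S ⊆ T) (hc : closure S ∩ T ⊆ S) : connectedComponentIn T x = S := by
  refine Subset.antisymm ?_ (hS.subset_connectedComponentIn hx hST)
  have h_cover : connectedComponentIn T x ⊆ S ∪ (closure S)ᶜ := fun y hy =>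
    (em (y ∈ closure S)).imp (fun h => hc ⟨h, connectedComponentIn_subset _ _ hy⟩) id
  exact IsPreconnected.subset_left_of_subset_union ho isClosed_closure.isOpen_compl
    (disjoint_compl_right.mono_left subset_closure) h_cover
    ⟨x, mem_connectedComponentIn (hST hx), hx⟩ isPreconnected_connectedComponentIn

theorem isComponentOf_connectedComponentIn (hx : x ∈ T) :
    IsComponentOf T (connectedComponentIn T x) := ⟨x, hx, rfl⟩

namespace IsComponentOf

theorem eq_of_mem (h : IsComponentOf T C) (hx : x ∈ C) : C = connectedComponentIn T x := by
  obtain ⟨y, _, rfl⟩ := h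
  exact connectedComponentIn_eq hx

theorem eq_of_mem_of_mem (h : IsComponentOf T C) (h' : IsComponentOf T C') (hx : x ∈ C)
    (hx' : x ∈ C') : C = C' := by
  rw [h.eq_of_mem hx, h'.eq_of_mem hx']

theorem subset (h : IsComponentOf T C) : C ⊆ T := by
  obtain ⟨y, _, rfl⟩ := h
  exact connectedComponentIn_subset _ _

theorem nonempty (h : IsComponentOf T C) : C.Nonempty := by
  obtain ⟨y, hy, rfl⟩ := h
  exact ⟨y, mem_connectedComponentIn hy⟩

theorem isPreconnected (h : IsComponentOf T C) : IsPreconnected C := by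
  obtain ⟨y, _, rfl⟩ := h
  exact isPreconnected_connectedComponentIn

theorem isOpen [LocallyConnectedSpace Y] (h : IsComponentOf T C) (hT : IsOpen T) : IsOpen C := by
  obtain ⟨y, _, rfl⟩ := h
  exact hT.connectedComponentIn

theorem subset_of_isPreconnected {S : Set Y} (h : IsComponentOf T C) (hS : IsPreconnected S)
    (hST : S ⊆ T) (hxS : x ∈ S) (hxC : x ∈ C) : S ⊆ C := by
  rw [h.eq_of_mem hxC]
  exact hS.subset_connectedComponentIn hxS hST

theorem mem_of_mem_closure (h : IsComponentOf T C) (hx : x ∈ closure C) (hxT : x ∈ T) :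
    x ∈ C := by
  have h_conn : IsPreconnected (insert x C) :=
    h.isPreconnected.subset_closure (subset_insert _ _) (insert_subset hx subset_closure)
  obtain ⟨y, hy⟩ := h.nonempty
  exact h.subset_of_isPreconnected h_conn (insert_subset hxT h.subset) (mem_insert_of_mem _ hy) hy
    (mem_insert _ _)

theorem mem_of_continuous {Z : Type*} [TopologicalSpace Z] [PreconnectedSpace Z] {γ : Z → Y}
    (h : IsComponentOf T C) (hγ : Continuous γ) (hT : ∀ t, γ t ∈ T) {a : Z} (ha : γ a ∈ C)
    (b : Z) : γ b ∈ C :=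
  h.subset_of_isPreconnected (isPreconnected_range hγ) (range_subset_iff.2 hT) (mem_range_self a)
    ha (mem_range_self b)

theorem image_homeomorph {Z : Type*} [TopologicalSpace Z] (f : Y ≃ₜ Z) (h : IsComponentOf T C) :
    IsComponentOf (f '' T) (f '' C) := by
  obtain ⟨y, hy, rfl⟩ := h
  exact ⟨f y, mem_image_of_mem _ hy, f.image_connectedComponentIn hy⟩

end IsComponentOf

end Components

section Lifting

variable {X Y : Type*} [TopologicalSpace X] [TopologicalSpace Y] {p : X → Y} {T N : Set Y}

theorem exists_lift {A : Type*} [TopologicalSpace A] [SimplyConnectedSpace A]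
    [LocallyPathConnectedSpace A] (hp : IsCoveringMapOn p T) {γ : A → Y} (hγ : Continuous γ)
    (hT : ∀ t, γ t ∈ T) {a : A} {x : X} (hx : p x = γ a) :
    ∃ Γ : C(A, X), Γ a = x ∧ ∀ t, p (Γ t) = γ t := by
  obtain ⟨Γ, ⟨hΓ, hpΓ⟩, -⟩ := hp.existsUnique_continuousMap_lifts ⟨γ, hγ⟩ hx hT
  exact ⟨Γ, hΓ, congr_fun hpΓ⟩

theorem eq_of_lifts_eq [T2Space X] {A : Type*} [TopologicalSpace A] [PreconnectedSpace A]
    (hp : IsLocalHomeomorph p) {Γ Γ' : A → X} (hΓ : Continuous Γ) (hΓ' : Continuous Γ')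
    (h : ∀ t, p (Γ t) = p (Γ' t)) {a : A} (ha : Γ a = Γ' a) : Γ = Γ' :=
  (T2Space.isSeparatedMap p).eq_of_comp_eq hp.isLocallyInjective hΓ hΓ' (funext h) a ha

theorem eqOn_of_sections_eq [T2Space X] (hp : IsLocalHomeomorph p) (hN : IsPreconnected N)
    {σ τ : Y → X} (hσ : ContinuousOn σ N) (hτ : ContinuousOn τ N) (hpσ : ∀ z ∈ N, p (σ z) = z)
    (hpτ : ∀ z ∈ N, p (τ z) = z) {y : Y} (hy : y ∈ N) (h : σ y = τ y) : EqOn σ τ N :=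
  (T2Space.isSeparatedMap p).eqOn_of_comp_eqOn hp.isLocallyInjective hN hσ hτ
    (fun z hz => (hpσ z hz).trans (hpτ z hz).symm) hy h

theorem isOpen_image_section (hp : IsLocalHomeomorph p) (hN : IsOpen N) {σ : Y → X}
    (hσ : ContinuousOn σ N) (hpσ : ∀ z ∈ N, p (σ z) = z) : IsOpen (σ '' N) := by
  have h_comp : p ∘ N.domRestrict σ = Subtype.val := funext fun z => hpσ z z.2
  have h_emb : IsOpenEmbedding (N.domRestrict σ) :=
    hp.isOpenEmbedding_of_comp (h_comp ▸ hN.isOpenEmbedding_subtypeVal) hσ.domRestrict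
  simpa only [range_domRestrict] using h_emb.isOpen_range

/-- There is a continuous section over `N` of the map `p` whose value at `p x` is `x`. Sections
are functions on all of `Y`, of which only the restriction to `N` matters. -/
def HasSectionThrough (p : X → Y) (N : Set Y) (x : X) : Prop :=
  ∃ σ : Y → X, ContinuousOn σ N ∧ (∀ z ∈ N, p (σ z) = z) ∧ σ (p x) = x

theorem HasSectionThrough.mono {N' : Set Y} {x : X} (h : HasSectionThrough p N x) (hN : N' ⊆ N) :
    HasSectionThrough p N' x :=
  let ⟨σ, hσ, hpσ, hx⟩ := h
  ⟨σ, hσ.mono hN, fun z hz => hpσ z (hN hz), hx⟩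

theorem exists_nhds_hasSectionThrough (hp : IsCoveringMapOn p T) {y : Y} (hy : y ∈ T) :
    ∃ N ∈ 𝓝 y, ∀ x, p x ∈ N → HasSectionThrough p N x := by
  obtain ⟨_, U, hyU, hU, _, H, hH⟩ := hp y hy
  refine ⟨U, hU.mem_nhds hyU, fun x hx => ?_⟩
  let sheet : U → X := fun z => (H.symm (z, (H ⟨x, hx⟩).2)).1
  have h_sheet (z : U) : p (sheet z) = z := by
    rw [← hH, Homeomorph.apply_symm_apply]
  have h_through : sheet ⟨p x, hx⟩ = x := by
    have h_base : (⟨p x, hx⟩ : U) = (H ⟨x, hx⟩).1 := Subtype.ext (hH ⟨x, hx⟩).symm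
    simp only [sheet, h_base, Prod.mk.eta, Homeomorph.symm_apply_apply]
  classical
  refine ⟨fun z => if hz : z ∈ U then sheet ⟨z, hz⟩ else x, ?_, fun z hz => ?_, ?_⟩
  · rw [continuousOn_iff_continuous_domRestrict]
    refine (show Continuous sheet by fun_prop).congr fun z => ?_
    simp only [domRestrict_apply, z.2, dif_pos]
  · simpa only [hz, dif_pos] using h_sheet ⟨z, hz⟩
  · simpa only [hx, dif_pos] using h_through

theorem isEvenlyCovered_of_sections [T2Space X] (hp : IsLocalHomeomorph p) (hNo : IsOpen N)
    (hN : IsPreconnected N) {y : Y} (hy : y ∈ N) {σ : p ⁻¹' {y} → Y → X}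
    (hσ : ∀ i, ContinuousOn (σ i) N) (hpσ : ∀ i, ∀ z ∈ N, p (σ i z) = z) (hσy : ∀ i, σ i y = i)
    (h_cover : p ⁻¹' N ⊆ ⋃ i, σ i '' N) : IsEvenlyCovered p y (p ⁻¹' {y}) := by
  rcases isEmpty_or_nonempty (p ⁻¹' {y}) with h_empty | ⟨⟨i₀⟩⟩
  · exact .of_preimage_eq_empty _ (hNo.mem_nhds hy) (by simpa using h_cover)
  have h_discrete : DiscreteTopology (p ⁻¹' {y}) :=
    (IsDiscrete.of_openPartialHomeomorph p subset_rfl fun x _ => (hp x).imp fun _ hφ =>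
      ⟨hφ.1, hφ.2.symm⟩).1
  have : Nonempty (p ⁻¹' {y}) := ⟨i₀⟩
  have : Nonempty (Y → X) := ⟨σ i₀⟩
  have h_disjoint (i j) (hij : i ≠ j) : Disjoint (σ i '' N) (σ j '' N) := by
    refine disjoint_left.2 ?_
    rintro _ ⟨z, hz, rfl⟩ ⟨w, hw, hwz⟩
    obtain rfl : w = z := by rw [← hpσ j w hw, hwz, hpσ i z hz]
    have h_eq := eqOn_of_sections_eq hp hN (hσ j) (hσ i) (hpσ j) (hpσ i) hw hwz
    exact hij (Subtype.ext ((hσy i).symm.trans ((h_eq hy).symm.trans (hσy j))))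
  have h_image (i) {W : Set Y} (hW : W ⊆ N) : p ⁻¹' W ∩ σ i '' N = σ i '' W := by
    ext x
    constructor
    · rintro ⟨hx, z, hz, rfl⟩
      exact ⟨z, hpσ i z hz ▸ hx, rfl⟩
    · rintro ⟨z, hz, rfl⟩
      exact ⟨mem_preimage.2 ((hpσ i z (hW hz)).symm ▸ hz), z, hW hz, rfl⟩
  refine .of_trivialization (t := hNo.trivializationDiscrete (fun i => σ i '' N) N
    (fun i W hW => ⟨fun hWo => ?_, fun hWo => ?_⟩) (fun i => ?_)
    (fun i z hz => ⟨σ i z, mem_image_of_mem _ hz, hpσ i z hz⟩) h_disjoint h_cover) hy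
  · rw [h_image i hW]
    exact isOpen_image_section hp hWo ((hσ i).mono hW) fun z hz => hpσ i z (hW hz)
  · rw [h_image i hW] at hWo
    simpa only [image_image, image_congr fun z hz => hpσ i z (hW hz), image_id'] using
      hp.isOpenMap _ hWo
  · rintro _ ⟨z, hz, rfl⟩ _ ⟨w, hw, rfl⟩ hzw
    rw [hpσ i z hz, hpσ i w hw] at hzw
    rw [hzw]

theorem isCoveringMapOn_of_hasSectionThrough [T2Space X] [LocallyConnectedSpace Y]
    (hp : IsLocalHomeomorph p)
    (h : ∀ y ∈ T, ∃ N ∈ 𝓝 y, ∀ x, p x ∈ N → HasSectionThrough p N x) : IsCoveringMapOn p T := by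
  intro y hy
  obtain ⟨N, hN, hs⟩ := h y hy
  have hyN : y ∈ interior N := mem_interior_iff_mem_nhds.2 hN
  have hyU := mem_connectedComponentIn hyN
  have hU : IsPreconnected (connectedComponentIn (interior N) y) :=
    isPreconnected_connectedComponentIn
  have h_section (x) (hx : p x ∈ connectedComponentIn (interior N) y) :
      HasSectionThrough p (connectedComponentIn (interior N) y) x :=
    have hUN := (connectedComponentIn_subset (interior N) y).trans interior_subset
    (hs x (hUN hx)).mono hUN
  choose σ hσ hpσ hσy using fun i : p ⁻¹' {y} => h_section i (i.2.symm ▸ hyU)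
  have hσ_y (i) : σ i y = i := by simpa only [show p i = y from i.2] using hσy i
  refine isEvenlyCovered_of_sections hp isOpen_interior.connectedComponentIn hU hyU hσ hpσ hσ_y
    fun x hx => ?_
  obtain ⟨τ, hτ, hpτ, hτx⟩ := h_section x hx
  let i : p ⁻¹' {y} := ⟨τ y, hpτ y hyU⟩
  have h_eq := eqOn_of_sections_eq hp hU (hσ i) hτ (hpσ i) hpτ hyU (hσ_y i)
  exact mem_iUnion.2 ⟨i, p x, hx, (h_eq hx).trans hτx⟩

end Lifting

section Disc

variable {X Y : Type*} [TopologicalSpace X] [TopologicalSpace Y] {p : X → Y} {e : ℂ → Y}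
  {F : Set X}

theorem finite_inter_preimage_of_isCompact (hp : IsLocalHomeomorph p) {Q : Set Y}
    (hQ : Q.Finite) {K : Set X} (hK : IsCompact K) : (K ∩ p ⁻¹' Q).Finite := by
  choose U hU hU_inj using isLocallyInjective_iff_nhds.1 hp.isLocallyInjective
  obtain ⟨t, -, ht⟩ := hK.elim_nhds_subcover U fun x _ => hU x
  refine (t.finite_toSet.biUnion (t := fun x => U x ∩ p ⁻¹' Q) fun x _ => ?_).subset ?_
  · refine .of_finite_image (hQ.subset ?_) ((hU_inj x).mono inter_subset_left)
    rintro _ ⟨u, hu, rfl⟩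
    exact hu.2
  · rintro u ⟨huK, huQ⟩
    obtain ⟨x, hx, hux⟩ := mem_iUnion₂.1 (ht huK)
    exact mem_iUnion₂.2 ⟨x, hx, hux, huQ⟩

theorem exists_lift_exp (he : IsOpenEmbedding e) (hs : IsCoveringMapOn p (range e \ {e 0}))
    {w : ℂ} {x : X} (hx : p x = e (Complex.exp w)) :
    ∃ Λ : C(ℂ, X), Λ w = x ∧ ∀ z, p (Λ z) = e (Complex.exp z) :=
  exists_lift hs (he.continuous.comp Complex.continuous_exp)
    (fun _ => ⟨mem_range_self _, he.injective.ne (Complex.exp_ne_zero _)⟩) hx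

theorem exists_lift_exp_mem (he : IsOpenEmbedding e) (hs : IsCoveringMapOn p (range e \ {e 0}))
    (hF : IsComponentOf (p ⁻¹' range e) F) {w : ℂ} {x : X} (hxF : x ∈ F)
    (hx : p x = e (Complex.exp w)) :
    ∃ Λ : C(ℂ, X), Λ w = x ∧ (∀ z, p (Λ z) = e (Complex.exp z)) ∧ ∀ z, Λ z ∈ F := by
  obtain ⟨Λ, hΛw, hpΛ⟩ := exists_lift_exp he hs hx
  exact ⟨Λ, hΛw, hpΛ, hF.mem_of_continuous Λ.continuous
    (fun z => ⟨Complex.exp z, (hpΛ z).symm⟩) (hΛw.symm ▸ hxF)⟩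

theorem closure_inter_preimage_ball_subset [T2Space Y] (hp : Continuous p) (he : Continuous e)
    (hF : IsComponentOf (p ⁻¹' range e) F) (r : ℝ) :
    closure (F ∩ p ⁻¹' (e '' Metric.ball 0 r)) ⊆
      F ∩ p ⁻¹' (e '' Metric.ball 0 r) ∪ F ∩ p ⁻¹' (e '' Metric.sphere 0 r) := by
  rw [← inter_union_distrib_left, ← preimage_union, ← image_union, Metric.ball_union_sphere]
  intro u hu
  have h_closed : IsClosed (p ⁻¹' (e '' Metric.closedBall 0 r)) :=
    ((isCompact_closedBall _ _).image he).isClosed.preimage hp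
  have hu' : u ∈ p ⁻¹' (e '' Metric.closedBall 0 r) :=
    closure_minimal (inter_subset_right.trans
      (preimage_mono (image_mono Metric.ball_subset_closedBall))) h_closed hu
  exact ⟨hF.mem_of_mem_closure (closure_mono inter_subset_left hu)
    (image_subset_range _ _ hu'), hu'⟩

theorem isPreconnected_compl_closedBall {R : ℝ} (hR : 0 < R) :
    IsPreconnected (Metric.closedBall (0 : ℂ) R)ᶜ := by
  have h_image : (Metric.closedBall (0 : ℂ) R)ᶜ = Complex.exp '' {z | Real.log R < z.re} := by
    ext z
    simp only [mem_compl_iff, mem_closedBall_zero_iff, not_le, mem_image, mem_ofPred_eq]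
    constructor
    · intro h
      have hz : z ≠ 0 := norm_pos_iff.1 (hR.trans h)
      exact ⟨Complex.log z, by rw [Complex.log_re]; exact Real.log_lt_log hR h,
        Complex.exp_log hz⟩
    · rintro ⟨w, hw, rfl⟩
      rw [Complex.norm_exp]
      exact (Real.log_lt_iff_lt_exp hR).1 hw
  rw [h_image]
  exact (convex_halfSpace_re_gt _).isPreconnected.image _ Complex.continuous_exp.continuousOn

theorem exists_isCompact_superset_isPreconnected_compl (φ : ℂ ≃ₜ X) {C : Set X}
    (hC : IsCompact C) : ∃ K, IsCompact K ∧ C ⊆ K ∧ IsPreconnected Kᶜ := by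
  obtain ⟨R, hR⟩ := (hC.image φ.symm.continuous).isBounded.subset_closedBall (0 : ℂ)
  have hR' : 0 < max R 1 := lt_max_of_lt_right one_pos
  refine ⟨φ '' Metric.closedBall 0 (max R 1), (isCompact_closedBall _ _).image φ.continuous,
    fun x hx => ⟨φ.symm x, ?_, φ.apply_symm_apply x⟩, ?_⟩
  · exact Metric.closedBall_subset_closedBall (le_max_left _ _) (hR (mem_image_of_mem _ hx))
  · rw [← image_compl_eq φ.bijective]
    exact (isPreconnected_compl_closedBall hR').image _ φ.continuous.continuousOn

variable [T2Space X]

theorem exists_periodic_lift_exp (hp : IsLocalHomeomorph p) (he : IsOpenEmbedding e)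
    (hs : IsCoveringMapOn p (range e \ {e 0})) {x : X} (hx : p x = e 0) :
    ∃ (Λ : C(ℂ, X)) (τ : ℂ → X) (δ : ℝ), (∀ z, p (Λ z) = e (Complex.exp z)) ∧
      Function.Periodic Λ (2 * Real.pi * Complex.I) ∧ ContinuousAt τ 0 ∧ τ 0 = x ∧ 0 < δ ∧
      ∀ z, ‖Complex.exp z‖ < δ → Λ z = τ (Complex.exp z) := by
  obtain ⟨q, hxq, rfl⟩ := hp x
  have h_target : e ⁻¹' q.target ∈ 𝓝 0 :=
    he.continuous.continuousAt.preimage_mem_nhds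
      (hx ▸ q.open_target.mem_nhds (q.map_source hxq))
  obtain ⟨δ, hδ, h_ball⟩ := Metric.mem_nhds_iff.1 h_target
  have h_small {z : ℂ} (hz : z.re < Real.log δ) : Complex.exp z ∈ Metric.ball (0 : ℂ) δ := by
    rwa [mem_ball_zero_iff, Complex.norm_exp, ← Real.lt_log_iff_exp_lt hδ]
  let τ : ℂ → X := q.symm ∘ e
  have hτ : ContinuousOn τ (Metric.ball 0 δ) :=
    q.continuousOn_symm.comp he.continuous.continuousOn h_ball
  have hqτ {z : ℂ} (hz : z ∈ Metric.ball (0 : ℂ) δ) : q (τ z) = e z := q.right_inv (h_ball hz)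
  have ha : ((Real.log δ - 1 : ℝ) : ℂ).re < Real.log δ := by simp
  generalize ((Real.log δ - 1 : ℝ) : ℂ) = a at ha
  obtain ⟨Λ, hΛa, hqΛ⟩ := exists_lift_exp he hs (hqτ (h_small ha))
  have h_local : EqOn Λ (τ ∘ Complex.exp) {z | z.re < Real.log δ} := by
    refine (T2Space.isSeparatedMap q).eqOn_of_comp_eqOn hp.isLocallyInjective
      (convex_halfSpace_re_lt _).isPreconnected Λ.continuous.continuousOn
      (hτ.comp Complex.continuous_exp.continuousOn fun z => h_small) (fun z hz => ?_) ha hΛa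
    exact (hqΛ z).trans (hqτ (h_small hz)).symm
  have h_periodic : Function.Periodic Λ (2 * Real.pi * Complex.I) := by
    refine congr_fun (eq_of_lifts_eq hp (Γ := fun z => Λ (z + 2 * Real.pi * Complex.I))
      (by fun_prop) Λ.continuous (fun z => ?_) (a := a) ?_)
    · rw [hqΛ, hqΛ, Complex.exp_periodic z]
    · have ha' : (a + 2 * Real.pi * Complex.I).re < Real.log δ := by simpa using ha
      rw [h_local ha, h_local ha', Function.comp_apply, Function.comp_apply,
        Complex.exp_periodic a]
  refine ⟨Λ, τ, δ, hqΛ, h_periodic, hτ.continuousAt (Metric.ball_mem_nhds _ hδ), ?_, hδ,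
    fun z hz => h_local ?_⟩
  · exact (congr_arg q.symm hx.symm).trans (q.left_inv hxq)
  · rwa [Complex.norm_exp, ← Real.lt_log_iff_exp_lt hδ] at hz

theorem exists_section_disc (hp : IsLocalHomeomorph p) (he : IsOpenEmbedding e)
    (hs : IsCoveringMapOn p (range e \ {e 0})) {x : X} (hx : p x = e 0) :
    ∃ σ : ℂ → X, Continuous σ ∧ (∀ w, p (σ w) = e w) ∧ σ 0 = x := by
  obtain ⟨Λ, τ, δ, hpΛ, h_periodic, hτ, hτ0, hδ, h_local⟩ := exists_periodic_lift_exp hp he hs hx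
  classical
  let σ : ℂ → X := fun z => if z = 0 then x else Λ (Complex.log z)
  have hσ0 : σ 0 = x := if_pos rfl
  have hσ_exp (z : ℂ) : σ (Complex.exp z) = Λ z := by
    obtain ⟨n, hn⟩ := Complex.exp_eq_exp_iff_exists_int.1
      (Complex.exp_log (Complex.exp_ne_zero z))
    simp only [σ, Complex.exp_ne_zero, if_false, hn]
    exact h_periodic.int_mul n z
  have hστ : ∀ᶠ z in 𝓝 0, τ z = σ z := by
    filter_upwards [Metric.ball_mem_nhds 0 hδ] with z hz
    rcases eq_or_ne z 0 with rfl | hz0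
    · rw [hσ0, hτ0]
    · rw [mem_ball_zero_iff, ← Complex.exp_log hz0] at hz
      rw [← Complex.exp_log hz0, hσ_exp, h_local _ hz]
  refine ⟨σ, continuous_iff_continuousAt.2 fun z => ?_, fun z => ?_, hσ0⟩ <;>
    rcases eq_or_ne z 0 with rfl | hz0
  · exact hτ.congr hστ
  · rw [ContinuousAt, ← Complex.exp_log hz0, ← (Complex.hasStrictDerivAt_exp _).map_nhds_eq
      (Complex.exp_ne_zero _), tendsto_map'_iff, hσ_exp,
      show σ ∘ Complex.exp = Λ from funext hσ_exp]
    exact Λ.continuous.continuousAt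
  · rw [hσ0, hx]
  · rw [← Complex.exp_log hz0, hσ_exp, hpΛ]

theorem connectedComponentIn_eq_range_section (hp : IsLocalHomeomorph p) (he : IsOpenEmbedding e)
    {σ : ℂ → X} (hσ : Continuous σ) (h : ∀ w, p (σ w) = e w) (w : ℂ) :
    connectedComponentIn (p ⁻¹' range e) (σ w) = range σ := by
  have h_open : IsOpen (range σ) :=
    (hp.isOpenEmbedding_of_comp (by rwa [show p ∘ σ = e from funext h]) hσ).isOpen_range
  refine connectedComponentIn_eq_of_isOpen (isPreconnected_range hσ) h_open (mem_range_self _) ?_ ?_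
  · rintro _ ⟨z, rfl⟩
    exact ⟨z, (h z).symm⟩
  rintro u ⟨hu, ⟨z, hz⟩⟩
  refine ⟨z, ?_⟩
  by_contra hne
  obtain ⟨U, V, hU, hV, hzU, huV, h_disj⟩ := t2_separation hne
  have h_nhds : V ∩ p ⁻¹' (e '' (σ ⁻¹' U)) ∈ 𝓝 u :=
    (hV.inter ((he.isOpenMap _ (hU.preimage hσ)).preimage hp.continuous)).mem_nhds
      ⟨huV, z, hzU, hz⟩
  obtain ⟨_, ⟨hV', w', hw', hw''⟩, w₁, rfl⟩ := mem_closure_iff_nhds.1 hu _ h_nhds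
  rw [h] at hw''
  obtain rfl := he.injective hw''
  exact disjoint_left.1 h_disj hw' hV'

theorem isCompact_inter_preimage_sphere (hp : IsLocalHomeomorph p) (he : IsOpenEmbedding e)
    (hs : IsCoveringMapOn p (range e \ {e 0})) (hF : IsComponentOf (p ⁻¹' range e) F) {r : ℝ}
    (hr : 0 < r) (hfin : {u ∈ F | p u = e r}.Finite) :
    IsCompact (F ∩ p ⁻¹' (e '' Metric.sphere 0 r)) := by
  have h_exp : Complex.exp (Real.log r : ℂ) = r := by
    rw [← Complex.ofReal_exp, Real.exp_log hr]
  choose Λ hΛ hpΛ hΛF using fun u : {u ∈ F | p u = e r} =>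
    exists_lift_exp_mem he hs hF u.2.1 (w := Real.log r) (h_exp.symm ▸ u.2.2)
  let Γ (u : {u ∈ F | p u = e r}) (θ : ℝ) : X := Λ u (Real.log r + θ * Complex.I)
  have h_union : F ∩ p ⁻¹' (e '' Metric.sphere 0 r) = ⋃ u, Γ u '' Icc (-Real.pi) Real.pi := by
    refine Subset.antisymm ?_ (iUnion_subset fun u => image_subset_iff.2 fun θ _ =>
      ⟨hΛF u _, _, ?_, (hpΛ u _).symm⟩)
    · rintro x ⟨hxF, w, hw, hwx⟩
      have hw_exp : Complex.exp (Real.log r + w.arg * Complex.I) = w := by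
        rw [Complex.exp_add, h_exp, ← mem_sphere_zero_iff_norm.1 hw,
          Complex.norm_mul_exp_arg_mul_I]
      obtain ⟨Λ', hΛ', hpΛ', hΛ'F⟩ := exists_lift_exp_mem he hs hF hxF
        (w := Real.log r + w.arg * Complex.I) (by rw [hw_exp, hwx])
      let u : {u ∈ F | p u = e r} := ⟨Λ' (Real.log r), hΛ'F _, by rw [hpΛ', h_exp]⟩
      have h_eq := eq_of_lifts_eq hp (Λ u).continuous Λ'.continuous
        (fun z => (hpΛ u z).trans (hpΛ' z).symm) (hΛ u)
      refine mem_iUnion.2 ⟨u, w.arg, ⟨(Complex.neg_pi_lt_arg w).le, Complex.arg_le_pi w⟩, ?_⟩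
      simp only [Γ, h_eq, hΛ']
    · simp [Complex.norm_exp, Real.exp_log hr]
  have : Finite {u ∈ F | p u = e r} := hfin
  rw [h_union]
  exact isCompact_iUnion fun u => isCompact_Icc.image (by fun_prop)

theorem not_inter_preimage_ball_subset [T2Space Y] (hp : Continuous p) (he : IsOpenEmbedding e)
    (hs : IsCoveringMapOn p (range e \ {e 0})) (hF : IsComponentOf (p ⁻¹' range e) F)
    (h0 : ∀ u ∈ F, p u ≠ e 0) {r : ℝ} (hr : 0 < r) {K : Set X} (hK : IsCompact K) :
    ¬ F ∩ p ⁻¹' (e '' Metric.ball 0 r) ⊆ K := by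
  intro hVK
  have h_compact : IsCompact (closure (F ∩ p ⁻¹' (e '' Metric.ball 0 r))) :=
    hK.of_isClosed_subset isClosed_closure (closure_minimal hVK hK.isClosed)
  obtain ⟨u, hu⟩ := hF.nonempty
  obtain ⟨w, hw⟩ := hF.subset hu
  have hw0 : w ≠ 0 := fun hw0 => h0 u hu (hw0 ▸ hw.symm)
  obtain ⟨Λ, -, hpΛ, hΛF⟩ := exists_lift_exp_mem he hs hF hu (w := Complex.log w)
    (by rw [Complex.exp_log hw0, hw])
  have h_exp : Tendsto (fun t : ℝ => Complex.exp t) atBot (𝓝 0) :=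
    Complex.tendsto_exp_comap_re_atBot.comp (tendsto_comap_iff.2 tendsto_id)
  have h_mem : e 0 ∈ p '' closure (F ∩ p ⁻¹' (e '' Metric.ball 0 r)) := by
    refine (h_compact.image hp).isClosed.mem_of_tendsto
      ((he.continuous.tendsto 0).comp h_exp) ?_
    filter_upwards [h_exp (Metric.ball_mem_nhds 0 hr)] with t ht
    exact ⟨Λ t, subset_closure ⟨hΛF t, _, ht, (hpΛ t).symm⟩, hpΛ t⟩
  obtain ⟨x, hx, hx0⟩ := h_mem
  have hxF : x ∈ F := (closure_inter_preimage_ball_subset hp he.continuous hF r hx).elim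
    (fun h => h.1) fun h => h.1
  exact h0 x hxF hx0

-- The part of `F` over a small disc leaves every compact set and has a compact frontier, so it
-- contains the (connected) complement of a large disc of the plane.
theorem exists_isCompact_compl_subset [T2Space Y] (hp : IsLocalHomeomorph p) (φ : ℂ ≃ₜ X)
    (he : IsOpenEmbedding e) (hs : IsCoveringMapOn p (range e \ {e 0}))
    (hF : IsComponentOf (p ⁻¹' range e) F) (h0 : ∀ u ∈ F, p u ≠ e 0) {r : ℝ} (hr : 0 < r)
    (hfin : {u ∈ F | p u = e r}.Finite) :
    ∃ K, IsCompact K ∧ Kᶜ ⊆ F ∩ p ⁻¹' (e '' Metric.ball 0 r) := by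
  have : LocallyConnectedSpace X := φ.symm.isOpenEmbedding.locallyConnectedSpace
  obtain ⟨K, hK, hCK, hK'⟩ := exists_isCompact_superset_isPreconnected_compl φ
    (isCompact_inter_preimage_sphere hp he hs hF hr hfin)
  have h_open : IsOpen (F ∩ p ⁻¹' (e '' Metric.ball 0 r)) :=
    (hF.isOpen (he.isOpen_range.preimage hp.continuous)).inter
      ((he.isOpenMap _ Metric.isOpen_ball).preimage hp.continuous)
  have h_cover : Kᶜ ⊆ F ∩ p ⁻¹' (e '' Metric.ball 0 r) ∪
      (closure (F ∩ p ⁻¹' (e '' Metric.ball 0 r)))ᶜ := by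
    intro z hz
    refine or_iff_not_imp_right.2 fun h => ?_
    exact (closure_inter_preimage_ball_subset hp.continuous he.continuous hF r
      (not_notMem.1 h)).resolve_right fun hzC => hz (hCK hzC)
  obtain ⟨z, hz, hzK⟩ :=
    not_subset.1 (not_inter_preimage_ball_subset hp.continuous he hs hF h0 hr hK)
  exact ⟨K, hK, hK'.subset_left_of_subset_union h_open isClosed_closure.isOpen_compl
    (disjoint_compl_right.mono_left subset_closure) h_cover ⟨z, hzK, hz⟩⟩

theorem exists_section_or_isComponentOf_punctured (hp : IsLocalHomeomorph p)
    (he : IsOpenEmbedding e) (hs : IsCoveringMapOn p (range e \ {e 0}))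
    (hF : IsComponentOf (p ⁻¹' range e) F) :
    (∃ σ : ℂ → X, Continuous σ ∧ (∀ w, p (σ w) = e w) ∧ F = range σ) ∨
      IsComponentOf (p ⁻¹' (range e \ {e 0})) F := by
  by_cases h : ∃ x ∈ F, p x = e 0
  · obtain ⟨x, hxF, hx⟩ := h
    obtain ⟨σ, hσ, hpσ, rfl⟩ := exists_section_disc hp he hs hx
    exact .inl ⟨σ, hσ, hpσ, (hF.eq_of_mem hxF).trans
      (connectedComponentIn_eq_range_section hp he hσ hpσ 0)⟩
  · push Not at h
    have hF' : F ⊆ p ⁻¹' (range e \ {e 0}) := fun u hu => ⟨hF.subset hu, h u hu⟩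
    obtain ⟨u, hu⟩ := hF.nonempty
    have h_comp := isComponentOf_connectedComponentIn (hF' hu)
    have hu' := mem_connectedComponentIn (hF' hu)
    refine .inr ⟨u, hF' hu,
      (h_comp.subset_of_isPreconnected hF.isPreconnected hF' hu hu').antisymm ?_⟩
    exact hF.subset_of_isPreconnected h_comp.isPreconnected
      (h_comp.subset.trans (preimage_mono sdiff_subset)) hu' hu

theorem exists_infinite_fibre [T2Space Y] (hp : IsLocalHomeomorph p) (φ : ℂ ≃ₜ X)
    (he : IsOpenEmbedding e) (hs : IsCoveringMapOn p (range e \ {e 0}))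
    (hF : IsComponentOf (p ⁻¹' range e) F) (h0 : ∀ u ∈ F, p u ≠ e 0) {Q : Set Y} (hQ : Q.Finite)
    (hinf : (p ⁻¹' Q).Infinite) : ∃ r : ℝ, 0 < r ∧ {u ∈ F | p u = e r}.Infinite := by
  have h_nhds : (e ⁻¹' (Q \ {e 0}))ᶜ ∈ 𝓝 0 :=
    ((hQ.subset sdiff_subset).isClosed.preimage he.continuous).isOpen_compl.mem_nhds (by simp)
  obtain ⟨r, hr, h_ball⟩ := Metric.mem_nhds_iff.1 h_nhds
  refine ⟨r, hr, fun hfin => hinf ?_⟩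
  obtain ⟨K, hK, hKc⟩ := exists_isCompact_compl_subset hp φ he hs hF h0 hr hfin
  refine (finite_inter_preimage_of_isCompact hp hQ hK).subset fun u hu => ⟨?_, hu⟩
  by_contra huK
  obtain ⟨huF, w, hw, hwu⟩ := hKc huK
  exact h_ball hw ⟨mem_preimage.2 (hwu ▸ hu), fun h => h0 u huF (hwu.symm.trans h)⟩

end Disc

section Sphere

@[simp] theorem conj_coe (z : ℂ) : conj (z : Sphere) = ((starRingEnd ℂ z : ℂ) : Sphere) := rfl

@[simp] theorem conj_infty : conj ∞ = ∞ := rfl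

theorem conj_conj (y : Sphere) : conj (conj y) = y := by
  induction y using OnePoint.rec with
  | infty => rfl
  | coe z => simp

/-- Complex conjugation as a homeomorphism of the sphere. -/
noncomputable def conjHomeo : Sphere ≃ₜ Sphere := Complex.conjCLE.toHomeomorph.onePointCongr

/-- The reflection `z ↦ 1 / z̄` in the unit circle, which exchanges `0` and `∞` and preserves every
ray from `0` to `∞`. -/
noncomputable def reflection (y : Sphere) : Sphere :=
  open Classical in
  y.elim ((0 : ℂ) : Sphere) fun z => if z = 0 then ∞ else ((starRingEnd ℂ z⁻¹ : ℂ) : Sphere)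

@[simp] theorem reflection_infty : reflection ∞ = ((0 : ℂ) : Sphere) := rfl

@[simp] theorem reflection_zero : reflection ((0 : ℂ) : Sphere) = ∞ := if_pos rfl

theorem reflection_coe {z : ℂ} (hz : z ≠ 0) :
    reflection (z : Sphere) = ((starRingEnd ℂ z⁻¹ : ℂ) : Sphere) := if_neg hz

theorem reflection_reflection (y : Sphere) : reflection (reflection y) = y := by
  induction y using OnePoint.rec with
  | infty => simp
  | coe z =>
    rcases eq_or_ne z 0 with rfl | hz
    · simp
    · rw [reflection_coe hz, reflection_coe (by simpa using hz)]
      simp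

theorem reflection_conj (y : Sphere) : reflection (conj y) = conj (reflection y) := by
  induction y using OnePoint.rec with
  | infty => simp
  | coe z =>
    rcases eq_or_ne z 0 with rfl | hz
    · simp
    · rw [reflection_coe hz, conj_coe, conj_coe, reflection_coe (by simpa using hz)]
      simp only [map_inv₀]

theorem continuous_reflection : Continuous reflection := by
  rw [OnePoint.continuous_iff, coclosedCompact_eq_cocompact, ← Metric.cobounded_eq_cocompact]
  have h_conj : Tendsto (starRingEnd ℂ) (𝓝 0) (𝓝 0) := by
    simpa only [map_zero] using Complex.continuous_conj.tendsto 0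
  have h_coe : Tendsto ((↑) : ℂ → Sphere) (Bornology.cobounded ℂ) (𝓝 ∞) := by
    rw [Metric.cobounded_eq_cocompact, ← coclosedCompact_eq_cocompact]
    exact OnePoint.tendsto_coe_infty
  constructor
  · refine ((OnePoint.continuous_coe.tendsto (0 : ℂ)).comp
      (h_conj.comp tendsto_inv₀_cobounded)).congr' ?_
    filter_upwards [Bornology.eventually_ne_cobounded (0 : ℂ)] with z hz
    exact (reflection_coe hz).symm
  refine continuous_iff_continuousAt.2 fun z => ?_
  rcases eq_or_ne z 0 with rfl | hz
  · rw [continuousAt_iff_punctured_nhds, reflection_zero]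
    refine (h_coe.comp (Complex.conjLIE.antilipschitz.tendsto_cobounded.comp
      tendsto_inv₀_nhdsNE_zero)).congr' ?_
    filter_upwards [self_mem_nhdsWithin] with w hw
    exact (reflection_coe hw).symm
  · have h_cont : ContinuousAt (fun w : ℂ => ((starRingEnd ℂ w⁻¹ : ℂ) : Sphere)) z :=
      (OnePoint.continuous_coe.comp Complex.continuous_conj).continuousAt.comp
        (continuousAt_inv₀ hz)
    refine h_cont.congr ?_
    filter_upwards [isOpen_ne.mem_nhds hz] with w hw
    exact (reflection_coe hw).symm

/-- The reflection in the unit circle as a homeomorphism of the sphere. -/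
noncomputable def reflectionHomeo : Sphere ≃ₜ Sphere where
  toFun := reflection
  invFun := reflection
  left_inv := reflection_reflection
  right_inv := reflection_reflection
  continuous_toFun := continuous_reflection
  continuous_invFun := continuous_reflection

@[simp] theorem reflectionHomeo_apply (y : Sphere) : reflectionHomeo y = reflection y := rfl

theorem disc_coe (z : ℂ) (r : ℝ) :
    disc (z : Sphere) r = ((↑) : ℂ → Sphere) '' Metric.ball z r := rfl

theorem coe_mem_disc_infty {z : ℂ} {r : ℝ} : (z : Sphere) ∈ disc ∞ r ↔ r⁻¹ < ‖z‖ := by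
  rw [← not_le, ← mem_closedBall_zero_iff]
  exact not_congr (OnePoint.coe_injective.mem_set_image)

theorem infty_mem_disc_infty (r : ℝ) : ∞ ∈ disc ∞ r := OnePoint.infty_notMem_image_coe

theorem preimage_reflectionHomeo_disc_zero {r : ℝ} (hr : 0 < r) :
    reflectionHomeo ⁻¹' disc ((0 : ℂ) : Sphere) r = disc ∞ r := by
  ext y
  rw [mem_preimage, reflectionHomeo_apply, disc_coe]
  induction y using OnePoint.rec with
  | infty =>
    exact iff_of_true ⟨0, Metric.mem_ball_self hr, rfl⟩ (infty_mem_disc_infty r)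
  | coe z =>
    rcases eq_or_ne z 0 with rfl | hz
    · simpa [coe_mem_disc_infty] using hr.le
    · rw [reflection_coe hz, OnePoint.coe_injective.mem_set_image, coe_mem_disc_infty,
        mem_ball_zero_iff, RCLike.norm_conj, norm_inv, inv_lt_comm₀ (norm_pos_iff.2 hz) hr]

theorem exists_disc_chart (a : Sphere) {r : ℝ} (hr : 0 < r) :
    ∃ e : ℂ → Sphere, IsOpenEmbedding e ∧ e 0 = a ∧ range e = disc a r := by
  have h_coe (z : ℂ) : ∃ e : ℂ → Sphere, IsOpenEmbedding e ∧ e 0 = (z : Sphere) ∧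
      range e = disc (z : Sphere) r := by
    let b := OpenPartialHomeomorph.univBall z r
    have hb : range b = Metric.ball z r := by
      rw [← image_univ, ← OpenPartialHomeomorph.univBall_source z r, b.image_source_eq_target,
        OpenPartialHomeomorph.univBall_target z hr]
    refine ⟨(↑) ∘ b, OnePoint.isOpenEmbedding_coe.comp
      (b.isOpenEmbedding (OpenPartialHomeomorph.univBall_source z r)), ?_, ?_⟩
    · simp only [Function.comp_apply, b, OpenPartialHomeomorph.univBall_apply_zero]
    · rw [disc_coe, ← hb, range_comp]
  induction a using OnePoint.rec with
  | coe z => exact h_coe z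
  | infty =>
    obtain ⟨e, he, h0, h_range⟩ := h_coe 0
    refine ⟨reflectionHomeo ∘ e, reflectionHomeo.isOpenEmbedding.comp he, by simp [h0], ?_⟩
    rw [range_comp, h_range, ← preimage_reflectionHomeo_disc_zero hr]
    exact reflectionHomeo.image_eq_preimage_symm _

theorem isOpen_disc (a : Sphere) (r : ℝ) : IsOpen (disc a r) := by
  induction a using OnePoint.rec with
  | coe z => exact OnePoint.isOpenEmbedding_coe.isOpenMap _ Metric.isOpen_ball
  | infty =>
    exact ((isCompact_closedBall _ _).image OnePoint.continuous_coe).isClosed.isOpen_compl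

theorem mem_disc_self (a : Sphere) {r : ℝ} (hr : 0 < r) : a ∈ disc a r := by
  induction a using OnePoint.rec with
  | coe z => exact mem_image_of_mem _ (Metric.mem_ball_self hr)
  | infty => exact infty_mem_disc_infty r

theorem conj_mem_disc {a y : Sphere} {r : ℝ} (ha : conj a = a) (hy : y ∈ disc a r) :
    conj y ∈ disc a r := by
  induction a using OnePoint.rec with
  | coe z =>
    obtain ⟨w, hw, rfl⟩ := hy
    have hz : starRingEnd ℂ z = z := OnePoint.coe_injective ha
    refine ⟨starRingEnd ℂ w, ?_, rfl⟩
    rwa [Metric.mem_ball, ← hz, Complex.dist_conj_conj]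
  | infty =>
    induction y using OnePoint.rec with
    | infty => exact hy
    | coe w =>
      rw [coe_mem_disc_infty] at hy
      rwa [conj_coe, coe_mem_disc_infty, RCLike.norm_conj]

theorem exists_isPreconnected_inter_disc_coe (z : ℂ) (r : ℝ) {y : Sphere} {U : Set Sphere}
    (hU : U ∈ 𝓝 y) : ∃ W ∈ 𝓝 y, W ⊆ U ∧ IsPreconnected (W ∩ disc (z : Sphere) r) := by
  induction y using OnePoint.rec with
  | infty =>
    have h_closed : IsClosed (((↑) : ℂ → Sphere) '' Metric.closedBall z r) :=
      ((isCompact_closedBall _ _).image OnePoint.continuous_coe).isClosed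
    refine ⟨U ∩ (((↑) : ℂ → Sphere) '' Metric.closedBall z r)ᶜ, inter_mem hU
      (h_closed.isOpen_compl.mem_nhds OnePoint.infty_notMem_image_coe), inter_subset_left, ?_⟩
    have h_empty : U ∩ (((↑) : ℂ → Sphere) '' Metric.closedBall z r)ᶜ ∩ disc (z : Sphere) r = ∅ :=
      (disjoint_compl_left_iff_subset.2 (image_mono Metric.ball_subset_closedBall)).mono_left
        inter_subset_right |>.inter_eq
    rw [h_empty]
    exact isPreconnected_empty
  | coe y =>
    obtain ⟨δ, hδ, h_ball⟩ := Metric.mem_nhds_iff.1 (OnePoint.continuous_coe.continuousAt hU)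
    refine ⟨(↑) '' Metric.ball y δ,
      OnePoint.isOpenEmbedding_coe.image_mem_nhds.2 (Metric.ball_mem_nhds _ hδ),
      image_subset_iff.2 h_ball, ?_⟩
    rw [disc_coe, ← image_inter OnePoint.coe_injective]
    exact ((convex_ball _ _).inter (convex_ball _ _)).isPreconnected.image _
      OnePoint.continuous_coe.continuousOn

theorem exists_isPreconnected_inter_disc (a : Sphere) {r : ℝ} (hr : 0 < r) {y : Sphere}
    {U : Set Sphere} (hU : U ∈ 𝓝 y) : ∃ W ∈ 𝓝 y, W ⊆ U ∧ IsPreconnected (W ∩ disc a r) := by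
  induction a using OnePoint.rec with
  | coe z => exact exists_isPreconnected_inter_disc_coe z r hU
  | infty =>
    obtain ⟨W, hW, hWU, h_conn⟩ := exists_isPreconnected_inter_disc_coe 0 r
      (reflectionHomeo.isOpenMap.image_mem_nhds hU)
    refine ⟨reflectionHomeo ⁻¹' W, reflectionHomeo.continuous.continuousAt.preimage_mem_nhds hW,
      (preimage_mono hWU).trans (preimage_image_eq U reflectionHomeo.injective).subset, ?_⟩
    rw [← preimage_reflectionHomeo_disc_zero hr, ← preimage_inter]
    exact reflectionHomeo.isPreconnected_preimage.2 h_conn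

instance : LocallyConnectedSpace Sphere :=
  locallyConnectedSpace_iff_connected_subsets.2 fun y _ hU =>
    let ⟨W, hW, hWU, h_conn⟩ := exists_isPreconnected_inter_disc y one_pos hU
    ⟨W ∩ disc y 1, inter_mem hW ((isOpen_disc y 1).mem_nhds (mem_disc_self y one_pos)), h_conn,
      inter_subset_left.trans hWU⟩

end Sphere

section Surface

variable {X : Type*} [TopologicalSpace X] {A : Set Sphere} {π : X → Sphere} {s : X → X}
  {D : DiscSystem A} {a : Sphere} {V : Set X}

namespace DiscSystem

theorem eq_of_mem (D : DiscSystem A) {b y : Sphere} (ha : a ∈ A) (hb : b ∈ A)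
    (hya : y ∈ disc a (D.radius a)) (hyb : y ∈ disc b (D.radius b)) : a = b := by
  by_contra h
  exact disjoint_left.1 (D.disjoint ha hb h) hya hyb

theorem self_mem (D : DiscSystem A) (ha : a ∈ A) : a ∈ disc a (D.radius a) :=
  mem_disc_self a (D.radius_pos a ha)

theorem notMem_of_mem_diff (D : DiscSystem A) {y : Sphere} (ha : a ∈ A)
    (hy : y ∈ disc a (D.radius a) \ {a}) : y ∉ A := fun h =>
  hy.2 (D.eq_of_mem h ha (D.self_mem h) hy.1)

end DiscSystem

namespace IsNSurface

theorem t2Space (hX : IsNSurface A π) : T2Space X :=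
  let ⟨φ⟩ := hX.plane
  φ.symm.t2Space

theorem isCoveringMapOn_disc (hX : IsNSurface A π) (D : DiscSystem A) (ha : a ∈ A) :
    IsCoveringMapOn π (disc a (D.radius a) \ {a}) :=
  hX.isCoveringMapOn.mono fun _ hy => D.notMem_of_mem_diff ha hy

theorem exists_section_or_isComponentOf (hX : IsNSurface A π) (D : DiscSystem A) (ha : a ∈ A)
    {e : ℂ → Sphere} (he : IsOpenEmbedding e) (h0 : e 0 = a)
    (h_range : range e = disc a (D.radius a)) {F : Set X}
    (hF : IsComponentOf (π ⁻¹' disc a (D.radius a)) F) :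
    (∃ σ : ℂ → X, Continuous σ ∧ (∀ w, π (σ w) = e w) ∧ F = range σ) ∨
      IsComponentOf (π ⁻¹' (disc a (D.radius a) \ {a})) F := by
  have := hX.t2Space
  have hs := hX.isCoveringMapOn_disc D ha
  subst h0
  rw [← h_range] at hs hF ⊢
  exact exists_section_or_isComponentOf_punctured hX.isLocalHomeomorph he hs hF

theorem exists_isLogSingularity_or_hasSectionThrough (hX : IsNSurface A π) (D : DiscSystem A)
    {Q : Set Sphere} (hQ : Q.Finite) (hinf : (π ⁻¹' Q).Infinite) (ha : a ∈ A) {x : X}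
    (hx : π x ∈ disc a (D.radius a)) :
    (∃ V, IsLogSingularity π a (D.radius a) V ∧ x ∈ V) ∨
      HasSectionThrough π (disc a (D.radius a)) x := by
  have := hX.t2Space
  obtain ⟨e, he, h0, h_range⟩ := exists_disc_chart a (D.radius_pos a ha)
  have hF := isComponentOf_connectedComponentIn (mem_preimage.2 hx)
  have hxF := mem_connectedComponentIn (mem_preimage.2 hx)
  rcases hX.exists_section_or_isComponentOf D ha he h0 h_range hF with ⟨σ, hσ, hπσ, hFσ⟩ | hF'
  · right
    obtain ⟨w, rfl⟩ := hFσ ▸ hxF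
    let e' := he.toOpenPartialHomeomorph e
    have h_target : e'.target = disc a (D.radius a) := by simp [e', h_range]
    refine ⟨σ ∘ e'.symm, hσ.comp_continuousOn (h_target ▸ e'.continuousOn_symm),
      fun z hz => (hπσ _).trans (e'.right_inv (h_target ▸ hz)), congr_arg σ ?_⟩
    rw [hπσ]
    exact e'.left_inv (by simp [e'])
  · left
    obtain ⟨φ⟩ := hX.plane
    have hs := hX.isCoveringMapOn_disc D ha
    refine ⟨_, ⟨hF', ?_⟩, hxF⟩
    subst h0
    rw [← h_range] at hF hs hF' ⊢
    obtain ⟨r, hr, h_fibre⟩ := exists_infinite_fibre hX.isLocalHomeomorph φ.symm he hs hF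
      (fun u hu => (hF'.subset hu).2) hQ hinf
    exact ⟨e r, ⟨mem_range_self _, he.injective.ne (Complex.ofReal_ne_zero.2 hr.ne')⟩, h_fibre⟩

end IsNSurface

theorem IsLogSingularity.isComponentOf_disc (hX : IsNSurface A π) (ha : a ∈ A)
    (hV : IsLogSingularity π a (D.radius a) V) : IsComponentOf (π ⁻¹' disc a (D.radius a)) V := by
  obtain ⟨e, he, h0, h_range⟩ := exists_disc_chart a (D.radius_pos a ha)
  obtain ⟨u, hu⟩ := hV.1.nonempty
  have huT : u ∈ π ⁻¹' disc a (D.radius a) := (hV.1.subset hu).1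
  have hF := isComponentOf_connectedComponentIn huT
  have huF := mem_connectedComponentIn huT
  have hVF :=
    hF.subset_of_isPreconnected hV.1.isPreconnected (fun v hv => (hV.1.subset hv).1) hu huF
  rcases hX.exists_section_or_isComponentOf D ha he h0 h_range hF with ⟨σ, -, hπσ, hFσ⟩ | hF'
  · obtain ⟨y, -, hinf⟩ := hV.2
    refine absurd (Subsingleton.finite ?_) hinf
    rintro v ⟨hv, hvy⟩ v' ⟨hv', hvy'⟩
    obtain ⟨w, rfl⟩ := hFσ ▸ hVF hv
    obtain ⟨w', rfl⟩ := hFσ ▸ hVF hv'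
    rw [mem_preimage, hπσ, mem_singleton_iff] at hvy hvy'
    rw [he.injective (hvy.trans hvy'.symm)]
  · exact hV.1.eq_of_mem_of_mem hF' hu huF ▸ hF

/-- The involution of a symmetric surface as a homeomorphism. -/
def IsSymmetricNSurface.involution (hX : IsSymmetricNSurface A π s) : X ≃ₜ X where
  toFun := s
  invFun := s
  left_inv := hX.involutive
  right_inv := hX.involutive
  continuous_toFun := hX.continuous_inv
  continuous_invFun := hX.continuous_inv

theorem conj_mem_disc_diff {r : ℝ} {y : Sphere} (ha : conj a = a) (hy : y ∈ disc a r \ {a}) :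
    conj y ∈ disc a r \ {a} :=
  ⟨conj_mem_disc ha hy.1, fun h => hy.2 <| by
    rw [mem_singleton_iff] at h ⊢
    rw [← conj_conj y, h, ha]⟩

theorem IsLogSingularity.image_involution (hX : IsSymmetricNSurface A π s) {r : ℝ}
    (ha : conj a = a) (hV : IsLogSingularity π a r V) : IsLogSingularity π a r (s '' V) := by
  have h_maps : MapsTo s (π ⁻¹' (disc a r \ {a})) (π ⁻¹' (disc a r \ {a})) := fun x hx => by
    rw [mem_preimage, hX.map_inv]
    exact conj_mem_disc_diff ha hx
  have h_image : s '' (π ⁻¹' (disc a r \ {a})) = π ⁻¹' (disc a r \ {a}) :=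
    h_maps.image_subset.antisymm fun x hx => ⟨s x, h_maps hx, hX.involutive x⟩
  obtain ⟨h_comp, y, hy, hinf⟩ := hV
  refine ⟨h_image ▸ h_comp.image_homeomorph hX.involution, conj y, conj_mem_disc_diff ha hy, ?_⟩
  refine (hinf.image hX.involutive.injective.injOn).mono ?_
  rintro _ ⟨x, ⟨hx, rfl⟩, rfl⟩
  exact ⟨mem_image_of_mem _ hx, hX.map_inv x⟩

end Surface

section HalfPlanes

variable {X : Type*} [TopologicalSpace X] {s : X → X} {φ : ℂ ≃ₜ X}

theorem mem_axis_iff (hφ : ∀ z, φ (starRingEnd ℂ z) = s (φ z)) (z : ℂ) :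
    φ z ∈ axis s ↔ z.im = 0 := by
  rw [axis, mem_ofPred_eq, ← hφ, φ.injective.eq_iff, Complex.conj_eq_iff_im]

theorem mem_of_convex (hφ : ∀ z, φ (starRingEnd ℂ z) = s (φ z)) {H : Set X}
    (hH : IsComponentOf (axis s)ᶜ H) {P : Set ℂ} (hP : Convex ℝ P) (hP_im : ∀ u ∈ P, u.im ≠ 0)
    {z w : ℂ} (hz : z ∈ P) (hw : w ∈ P) (hzH : φ z ∈ H) : φ w ∈ H := by
  refine hH.subset_of_isPreconnected (hP.isPreconnected.image φ φ.continuous.continuousOn) ?_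
    (mem_image_of_mem φ hz) hzH (mem_image_of_mem φ hw)
  rintro _ ⟨u, hu, rfl⟩
  exact mt (mem_axis_iff hφ u).1 (hP_im u hu)

theorem mem_or_mem_of_isComponentOf (hφ : ∀ z, φ (starRingEnd ℂ z) = s (φ z)) {H : Set X}
    (hH : IsComponentOf (axis s)ᶜ H) {x : X} (hx : x ∉ axis s) : x ∈ H ∨ s x ∈ H := by
  obtain ⟨y, hy⟩ := hH.nonempty
  obtain ⟨z, rfl⟩ := φ.surjective y
  obtain ⟨w, rfl⟩ := φ.surjective x
  have hz := mt (mem_axis_iff hφ z).2 (hH.subset hy)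
  rw [mem_axis_iff hφ] at hx
  have h_upper {w : ℂ} (hz : 0 < z.im) (hw : 0 < w.im) : φ w ∈ H :=
    mem_of_convex hφ hH (convex_halfSpace_im_gt 0) (fun u (hu : 0 < u.im) => hu.ne') hz hw hy
  have h_lower {w : ℂ} (hz : z.im < 0) (hw : w.im < 0) : φ w ∈ H :=
    mem_of_convex hφ hH (convex_halfSpace_im_lt 0) (fun u (hu : u.im < 0) => hu.ne) hz hw hy
  rw [← hφ]
  rcases lt_or_gt_of_ne hz with hz | hz <;> rcases lt_or_gt_of_ne hx with hw | hw
  · exact .inl (h_lower hz hw)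
  · exact .inr (h_lower hz (by simpa using hw))
  · exact .inr (h_upper hz (by simpa using hw))
  · exact .inl (h_upper hz hw)

theorem subset_or_subset_image_of_isComponentOf (hs : Continuous s) (hs_inv : Function.Involutive s)
    (hφ : ∀ z, φ (starRingEnd ℂ z) = s (φ z)) {H V : Set X} (hH : IsComponentOf (axis s)ᶜ H)
    (hV : IsPreconnected V) (hVs : V ⊆ (axis s)ᶜ) : V ⊆ H ∨ V ⊆ s '' H := by
  rcases V.eq_empty_or_nonempty with rfl | ⟨x, hx⟩
  · exact .inl (empty_subset _)
  rcases mem_or_mem_of_isComponentOf hφ hH (hVs hx) with h | h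
  · exact .inl (hH.subset_of_isPreconnected hV hVs hx h)
  · refine .inr fun v hv => ⟨s v, ?_, hs_inv v⟩
    refine hH.subset_of_isPreconnected (hV.image s hs.continuousOn) ?_ (mem_image_of_mem s hx) h
      (mem_image_of_mem s hv)
    rintro _ ⟨u, hu, rfl⟩ hsu
    exact hVs hu (hs_inv.injective hsu)

end HalfPlanes

section Deformation

variable {X : Type*} [TopologicalSpace X]

theorem isLocalHomeomorph_of_eventually_eq {Y : Type*} [TopologicalSpace Y] {p q : X → Y}
    (hp : IsLocalHomeomorph p) (h : ∀ x, ∃ ψ : Y ≃ₜ Y, ∀ᶠ u in 𝓝 x, q u = ψ (p u)) :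
    IsLocalHomeomorph q := by
  refine .mk q fun x => ?_
  obtain ⟨ψ, hψ⟩ := h x
  obtain ⟨e, hxe, rfl⟩ := hp x
  obtain ⟨W, hW, hWo, hxW⟩ := mem_nhds_iff.1 hψ
  refine ⟨(e.restrOpen W hWo).trans ψ.toOpenPartialHomeomorph, by simp [hxe, hxW], fun u hu => ?_⟩
  simp only [OpenPartialHomeomorph.trans_source, OpenPartialHomeomorph.restrOpen_source,
    Homeomorph.toOpenPartialHomeomorph_source, preimage_univ, inter_univ] at hu
  simpa using hW hu.2

theorem HasSectionThrough.of_homeomorph {Y : Type*} [TopologicalSpace Y] {q : X → Y} (ψ : Y ≃ₜ Y)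
    {W N : Set Y} {σ : Y → X} (hσ : ContinuousOn σ W) (hqσ : ∀ z ∈ W, q (σ z) = ψ z)
    (hN : N ⊆ ψ '' W) {z : Y} (hz : z ∈ W) : HasSectionThrough q N (σ z) := by
  have h_maps : MapsTo ψ.symm N W := fun w hw => by
    obtain ⟨u, hu, rfl⟩ := hN hw
    rwa [ψ.symm_apply_apply]
  refine ⟨σ ∘ ψ.symm, hσ.comp ψ.symm.continuous.continuousOn h_maps, fun w hw => ?_, ?_⟩
  · rw [Function.comp_apply, hqσ _ (h_maps hw), ψ.apply_symm_apply]
  · rw [Function.comp_apply, hqσ z hz, ψ.symm_apply_apply]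

theorem apply_mem_iff_of_forall_notMem {Y : Type*} {d : Set Y} {χ : Y → Y}
    (hχ : Function.Injective χ) (h : ∀ y ∉ d, χ y = y) {y : Y} : χ y ∈ d ↔ y ∈ d := by
  refine ⟨fun hy => ?_, fun hy => ?_⟩ <;> by_contra hy'
  · exact hy' (h y hy' ▸ hy)
  · rw [hχ (h _ hy')] at hy'
    exact hy' hy

theorem exists_nhds_hasSectionThrough_of_isComponentOf {Y : Type*} [TopologicalSpace Y]
    [LocallyConnectedSpace Y] {p q : X → Y} {T : Set Y} (hp : IsCoveringMapOn p T) (hT : IsOpen T)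
    (χ : Y ≃ₜ Y) {y : Y} (hy : χ.symm y ∈ T) :
    ∃ N ∈ 𝓝 y, ∀ V, IsComponentOf (p ⁻¹' T) V → (∀ x ∈ V, q x = χ (p x)) →
      ∀ x ∈ V, q x ∈ N → HasSectionThrough q N x := by
  obtain ⟨U, hU, h_section⟩ := exists_nhds_hasSectionThrough hp hy
  obtain ⟨W, hW, hW_conn, hWU⟩ := locallyConnectedSpace_iff_connected_subsets.1 ‹_› _ _
    (inter_mem hU (hT.mem_nhds hy))
  refine ⟨χ '' W, by simpa using χ.isOpenMap.image_mem_nhds hW, fun V hV hq x hxV hx => ?_⟩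
  rw [hq x hxV, χ.injective.mem_set_image] at hx
  obtain ⟨σ, hσ, hpσ, hσx⟩ := (h_section x (hWU hx).1).mono fun z (hz : z ∈ W) => (hWU hz).1
  have hσV : σ '' W ⊆ V := by
    refine hV.subset_of_isPreconnected (hW_conn.image σ hσ) ?_ ⟨_, hx, hσx⟩ hxV
    rintro _ ⟨z, hz, rfl⟩
    rw [mem_preimage, hpσ z hz]
    exact (hWU hz).2
  rw [← hσx]
  refine .of_homeomorph χ hσ (fun z hz => ?_) Subset.rfl hx
  rw [hq _ (hσV (mem_image_of_mem σ hz)), hpσ z hz]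

variable {A : Set Sphere} {π : X → Sphere} {s : X → X} {D : DiscSystem A} {a y : Sphere}

theorem DiscSystem.exists_isPreconnected_inter_disc (D : DiscSystem A) (hA : A.Finite)
    {U : Set Sphere} (hU : U ∈ 𝓝 y) :
    ∃ W ∈ 𝓝 y, W ⊆ U ∧ ∀ a ∈ A, IsPreconnected (W ∩ disc a (D.radius a)) := by
  choose! W hW hWU h_conn using fun a ha =>
    NSurface.exists_isPreconnected_inter_disc a (D.radius_pos a ha) hU
  refine ⟨{z ∈ U | ∀ a ∈ A, z ∈ disc a (D.radius a) → z ∈ W a}, ?_, sep_subset _ _, fun a ha => ?_⟩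
  · filter_upwards [hU, (biInter_mem hA).2 hW] with z hzU hz
    exact ⟨hzU, fun a ha _ => mem_iInter₂.1 hz a ha⟩
  · convert h_conn a ha using 1
    ext z
    refine and_congr_left fun hza => ⟨fun hz => hz.2 a ha hza, fun hz => ⟨hWU a ha hz, ?_⟩⟩
    intro b hb hzb
    exact D.eq_of_mem ha hb hza hzb ▸ hz

namespace Deformation

variable (E : Deformation π s D)

theorem moved_subset_base : E.moved ⊆ A := fun _ h => (E.moved_subset h).1

/-- The homeomorphism that describes the deformation in the second halfplane. -/
noncomputable def ηConj (a : Sphere) : Sphere ≃ₜ Sphere :=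
  (conjHomeo.trans (E.η a)).trans conjHomeo

theorem ηConj_apply (a y : Sphere) : E.ηConj a y = conj (E.η a (conj y)) := rfl

/-- The homeomorphisms that relate the deformed map to the original one over the disc about `a`. -/
def localModels (a : Sphere) : Set (Sphere ≃ₜ Sphere) :=
  {Homeomorph.refl Sphere, E.η a, E.ηConj a}

/-- The homeomorphisms that restrict to a local model on the disc about each moved point, and to
the identity on the complement of these discs. -/
def models : Set (Sphere ≃ₜ Sphere) :=
  {ψ | (∀ a ∈ E.moved, ∃ χ ∈ E.localModels a, EqOn ψ χ (disc a (D.radius a))) ∧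
    ∀ y, (∀ a ∈ E.moved, y ∉ disc a (D.radius a)) → ψ y = y}

variable {E}

theorem apply_eq_of_mem_localModels (ha : a ∈ E.moved) {χ : Sphere ≃ₜ Sphere}
    (hχ : χ ∈ E.localModels a) (hy : y ∉ disc a (D.radius a)) : χ y = y := by
  rcases hχ with rfl | rfl | rfl
  · rfl
  · exact E.η_off a ha y hy
  · rw [ηConj_apply, E.η_off a ha, conj_conj]
    exact fun h => hy (conj_conj y ▸ conj_mem_disc (E.moved_subset ha).2 h)

theorem apply_mem_disc_iff_of_mem_localModels (ha : a ∈ E.moved) {χ : Sphere ≃ₜ Sphere}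
    (hχ : χ ∈ E.localModels a) : χ y ∈ disc a (D.radius a) ↔ y ∈ disc a (D.radius a) :=
  apply_mem_iff_of_forall_notMem χ.injective fun _ => apply_eq_of_mem_localModels ha hχ

theorem apply_mem_disc_iff_of_mem_models (ha : a ∈ A) {ψ : Sphere ≃ₜ Sphere} (hψ : ψ ∈ E.models) :
    ψ y ∈ disc a (D.radius a) ↔ y ∈ disc a (D.radius a) := by
  by_cases h : ∃ b ∈ E.moved, y ∈ disc b (D.radius b)
  · obtain ⟨b, hb, hyb⟩ := h
    obtain ⟨χ, hχ, hψχ⟩ := hψ.1 b hb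
    have hχb := (apply_mem_disc_iff_of_mem_localModels hb hχ).2 hyb
    rw [hψχ hyb]
    constructor <;> intro h
    · rwa [D.eq_of_mem ha (E.moved_subset_base hb) h hχb]
    · rwa [D.eq_of_mem ha (E.moved_subset_base hb) h hyb]
  · push Not at h
    rw [hψ.2 y h]

theorem finite_moved (hA : A.Finite) : E.moved.Finite := hA.subset E.moved_subset_base

theorem finite_models (hA : A.Finite) : E.models.Finite := by
  have : Finite E.moved := (finite_moved hA).to_subtype
  choose! c hc hψc using fun ψ (hψ : ψ ∈ E.models) => hψ.1
  have hfin : {f : E.moved → Sphere ≃ₜ Sphere | ∀ a : E.moved, f a ∈ E.localModels a}.Finite :=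
    Set.Finite.pi' fun _ => ((finite_singleton _).insert _).insert _
  have h_maps : MapsTo (fun ψ (a : E.moved) => c ψ a) E.models
      {f | ∀ a : E.moved, f a ∈ E.localModels a} := fun ψ hψ a => hc ψ hψ a a.2
  refine Set.Finite.of_injOn h_maps ?_ hfin
  intro ψ hψ ψ' hψ' h
  ext y
  by_cases hy : ∃ a ∈ E.moved, y ∈ disc a (D.radius a)
  · obtain ⟨a, ha, hya⟩ := hy
    have h_eq : c ψ a = c ψ' a := congr_fun h (⟨a, ha⟩ : E.moved)
    rw [hψc ψ hψ a ha hya, hψc ψ' hψ' a ha hya, h_eq]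
  · push Not at hy
    rw [hψ.2 y hy, hψ'.2 y hy]

theorem exists_homeomorph_eqOn {c : Sphere → Sphere ≃ₜ Sphere}
    (hc : ∀ a ∈ E.moved, c a ∈ E.localModels a) {T : Set Sphere} (hT : T.Finite)
    (hTE : T ⊆ E.moved) : ∃ ψ : Sphere ≃ₜ Sphere, (∀ a ∈ T, EqOn ψ (c a) (disc a (D.radius a))) ∧
      ∀ y, (∀ a ∈ T, y ∉ disc a (D.radius a)) → ψ y = y := by
  induction T, hT using Set.Finite.induction_on with
  | empty => exact ⟨Homeomorph.refl _, by simp, fun _ _ => rfl⟩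
  | @insert b T hbT _ ih =>
    have hb := hTE (mem_insert _ _)
    obtain ⟨ψ, hψ, hψ_off⟩ := ih ((subset_insert _ _).trans hTE)
    have h_disjoint {a y : Sphere} (ha : a ∈ T) (hya : y ∈ disc a (D.radius a)) :
        y ∉ disc b (D.radius b) := fun hyb =>
      hbT (D.eq_of_mem (E.moved_subset_base (hTE (mem_insert_of_mem _ ha)))
        (E.moved_subset_base hb) hya hyb ▸ ha)
    refine ⟨(c b).trans ψ, ?_, fun y hy => ?_⟩
    · rintro a (rfl | ha) y hy
      · exact hψ_off _ fun a' ha' hy' =>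
          h_disjoint ha' hy' ((apply_mem_disc_iff_of_mem_localModels hb (hc _ hb)).2 hy)
      · rw [Homeomorph.trans_apply, apply_eq_of_mem_localModels hb (hc b hb) (h_disjoint ha hy),
          hψ a ha hy]
    · rw [Homeomorph.trans_apply,
        apply_eq_of_mem_localModels hb (hc b hb) (hy b (mem_insert _ _))]
      exact hψ_off y fun a ha => hy a (mem_insert_of_mem _ ha)

variable {φ : ℂ ≃ₜ X} {V : Set X} {x : X}

theorem subset_half_or_subset_image_half (hX : IsSymmetricNSurface A π s)
    (hφ : ∀ z, φ (starRingEnd ℂ z) = s (φ z)) (ha : a ∈ E.moved)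
    (hV : IsLogSingularity π a (D.radius a) V) : V ⊆ E.half ∨ V ⊆ s '' E.half := by
  refine subset_or_subset_image_of_isComponentOf hX.continuous_inv hX.involutive hφ E.half_spec
    hV.1.isPreconnected fun v hv hvs => ?_
  have hVs := hV.image_involution hX (E.moved_subset ha).2
  exact E.not_real (a, V)
    ⟨E.moved_subset ha, hV, hVs.1.eq_of_mem_of_mem hV.1 (x := v) ⟨v, hv, hvs⟩ hv⟩ ha

theorem map_involution (hX : IsSymmetricNSurface A π s)
    (hφ : ∀ z, φ (starRingEnd ℂ z) = s (φ z)) (x : X) : E.map (s x) = conj (E.map x) := by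
  by_cases h : ∃ a ∈ E.moved, ∃ V, IsLogSingularity π a (D.radius a) V ∧ x ∈ V
  · obtain ⟨a, ha, V, hV, hx⟩ := h
    have hVs := hV.image_involution hX (E.moved_subset ha).2
    have hsx : s x ∈ s '' V := mem_image_of_mem _ hx
    rcases subset_half_or_subset_image_half hX hφ ha hV with h | h
    · rw [E.map_plus a ha V hV h x hx, E.map_minus a ha _ hVs (image_mono h) _ hsx, hX.map_inv,
        conj_conj]
    · have h' : s '' V ⊆ E.half := by
        rintro _ ⟨v, hv, rfl⟩
        obtain ⟨u, hu, rfl⟩ := h hv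
        rwa [hX.involutive]
      rw [E.map_minus a ha V hV h x hx, E.map_plus a ha _ hVs h' _ hsx, hX.map_inv, conj_conj]
  · push Not at h
    rw [E.map_otherwise x h, E.map_otherwise (s x), hX.map_inv]
    intro a ha V hV hx
    exact h a ha _ (hV.image_involution hX (E.moved_subset ha).2) ⟨s x, hx, hX.involutive x⟩

theorem exists_model_of_isLogSingularity (hX : IsSymmetricNSurface A π s)
    (hφ : ∀ z, φ (starRingEnd ℂ z) = s (φ z)) (ha : a ∈ E.moved)
    (hV : IsLogSingularity π a (D.radius a) V) :
    ∃ χ ∈ ({E.η a, E.ηConj a} : Set (Sphere ≃ₜ Sphere)), ∀ x ∈ V, E.map x = χ (π x) := by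
  rcases subset_half_or_subset_image_half hX hφ ha hV with h | h
  · exact ⟨_, .inl rfl, E.map_plus a ha V hV h⟩
  · exact ⟨_, .inr rfl, E.map_minus a ha V hV h⟩

theorem map_eq_of_forall_notMem (ha : a ∈ A) (hx : π x ∈ disc a (D.radius a))
    (h : ∀ V, IsLogSingularity π a (D.radius a) V → x ∉ V) : E.map x = π x := by
  refine E.map_otherwise x fun b hb V hV hxV => ?_
  obtain rfl : b = a := D.eq_of_mem (E.moved_subset_base hb) ha (hV.1.subset hxV).1 hx
  exact h V hV hxV

theorem map_eq_of_forall_notMem_disc (hx : ∀ a ∈ E.moved, π x ∉ disc a (D.radius a)) :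
    E.map x = π x :=
  E.map_otherwise x fun a ha _ hV hxV => hx a ha (hV.1.subset hxV).1

theorem exists_localModel (hX : IsSymmetricNSurface A π s)
    (hφ : ∀ z, φ (starRingEnd ℂ z) = s (φ z)) (ha : a ∈ E.moved) {C : Set X}
    (hC : IsPreconnected C) (hCa : C ⊆ π ⁻¹' disc a (D.radius a)) :
    ∃ χ ∈ E.localModels a, ∀ x ∈ C, E.map x = χ (π x) := by
  have haA := E.moved_subset_base ha
  by_cases h : ∃ V, IsLogSingularity π a (D.radius a) V ∧ ∃ x ∈ C, x ∈ V
  · obtain ⟨V, hV, x, hxC, hxV⟩ := h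
    have hCV := (hV.isComponentOf_disc hX.toIsNSurface haA).subset_of_isPreconnected hC hCa hxC hxV
    obtain ⟨χ, hχ, h_map⟩ := exists_model_of_isLogSingularity hX hφ ha hV
    exact ⟨χ, .inr hχ, fun x hx => h_map x (hCV hx)⟩
  · push Not at h
    exact ⟨_, .inl rfl, fun x hx => map_eq_of_forall_notMem haA (hCa hx) fun V hV => h V hV x hx⟩

theorem exists_model_section (hX : IsSymmetricNSurface A π s)
    (hφ : ∀ z, φ (starRingEnd ℂ z) = s (φ z)) {W : Set Sphere} {σ : Sphere → X}
    (hσ : ContinuousOn σ W) (hπσ : ∀ z ∈ W, π (σ z) = z)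
    (hW : ∀ a ∈ E.moved, IsPreconnected (W ∩ disc a (D.radius a))) :
    ∃ ψ ∈ E.models, ∀ z ∈ W, E.map (σ z) = ψ z := by
  have h_local (a) (ha : a ∈ E.moved) : ∃ χ ∈ E.localModels a,
      ∀ x ∈ σ '' (W ∩ disc a (D.radius a)), E.map x = χ (π x) := by
    refine exists_localModel hX hφ ha ((hW a ha).image σ (hσ.mono inter_subset_left)) ?_
    rintro _ ⟨z, hz, rfl⟩
    rw [mem_preimage, hπσ z hz.1]
    exact hz.2
  choose! c hc h_map using h_local
  obtain ⟨ψ, hψ, hψ_off⟩ := exists_homeomorph_eqOn hc (finite_moved hX.finite_base) Subset.rfl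
  refine ⟨ψ, ⟨fun a ha => ⟨c a, hc a ha, hψ a ha⟩, hψ_off⟩, fun z hz => ?_⟩
  by_cases h : ∃ a ∈ E.moved, z ∈ disc a (D.radius a)
  · obtain ⟨a, ha, hza⟩ := h
    rw [hψ a ha hza, h_map a ha _ (mem_image_of_mem _ ⟨hz, hza⟩), hπσ z hz]
  · push Not at h
    rw [hψ_off z h, map_eq_of_forall_notMem_disc (by rwa [hπσ z hz]), hπσ z hz]

theorem exists_model (hX : IsSymmetricNSurface A π s) (hφ : ∀ z, φ (starRingEnd ℂ z) = s (φ z))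
    (x : X) : ∃ ψ ∈ E.models, E.map x = ψ (π x) := by
  obtain ⟨ψ, hψ, h⟩ := exists_model_section (E := E) (W := {π x}) (σ := fun _ => x) hX hφ
    continuousOn_const (fun z hz => hz.symm)
    fun a _ => (subsingleton_singleton.anti inter_subset_left).isPreconnected
  exact ⟨ψ, hψ, h _ rfl⟩

theorem isLocalHomeomorph_map (hX : IsSymmetricNSurface A π s)
    (hφ : ∀ z, φ (starRingEnd ℂ z) = s (φ z)) : IsLocalHomeomorph E.map := by
  refine isLocalHomeomorph_of_eventually_eq hX.isLocalHomeomorph fun x => ?_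
  obtain ⟨q, hxq, rfl⟩ := hX.isLocalHomeomorph x
  obtain ⟨W, hW, hWq, h_conn⟩ := D.exists_isPreconnected_inter_disc hX.finite_base
    (q.open_target.mem_nhds (q.map_source hxq))
  obtain ⟨ψ, -, hψ⟩ := exists_model_section (E := E) hX hφ (q.continuousOn_symm.mono hWq)
    (fun z hz => q.right_inv (hWq hz)) fun a ha => h_conn a (E.moved_subset_base ha)
  refine ⟨ψ, ?_⟩
  filter_upwards [q.continuousAt hxq hW, q.open_source.mem_nhds hxq] with u hu huq
  rw [← hψ _ hu, q.left_inv huq]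

theorem exists_nhds_hasSectionThrough_of_forall_notMem_disc (hX : IsSymmetricNSurface A π s)
    (hφ : ∀ z, φ (starRingEnd ℂ z) = s (φ z)) (hy : ∀ a ∈ E.moved, y ∉ disc a (D.radius a))
    (hyA : y ∉ A) : ∃ N ∈ 𝓝 y, ∀ x, E.map x ∈ N → HasSectionThrough E.map N x := by
  obtain ⟨U, hU, h_section⟩ := exists_nhds_hasSectionThrough hX.isCoveringMapOn hyA
  obtain ⟨W, hW, hWU, h_conn⟩ := D.exists_isPreconnected_inter_disc hX.finite_base hU
  refine ⟨⋂ ψ ∈ E.models, ψ '' W, (biInter_mem (finite_models hX.finite_base)).2 fun ψ hψ => ?_,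
    fun x hx => ?_⟩
  · simpa only [hψ.2 y hy] using ψ.isOpenMap.image_mem_nhds hW
  · have hxW : π x ∈ W := by
      obtain ⟨ψ, hψ, h_map⟩ := exists_model (E := E) hX hφ x
      rw [← ψ.injective.mem_set_image, ← h_map]
      exact mem_iInter₂.1 hx ψ hψ
    obtain ⟨σ, hσ, hπσ, hσx⟩ := h_section x (hWU hxW)
    obtain ⟨ψ, hψ, h_map⟩ := exists_model_section (E := E) hX hφ (hσ.mono hWU)
      (fun z hz => hπσ z (hWU hz)) fun a ha => h_conn a (E.moved_subset_base ha)
    rw [← hσx]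
    exact .of_homeomorph ψ (hσ.mono hWU) h_map (iInter₂_subset ψ hψ) hxW

theorem apply_mem_base (ha : a ∈ E.moved) {χ : Sphere ≃ₜ Sphere}
    (hχ : χ ∈ ({E.η a, E.ηConj a} : Set (Sphere ≃ₜ Sphere))) : χ a ∈ E.base := by
  refine .inr ⟨a, ha, ?_⟩
  rcases hχ with rfl | rfl
  · exact .inl (E.η_base a ha)
  · exact .inr (by rw [ηConj_apply, (E.moved_subset ha).2, E.η_base a ha])

theorem exists_nhds_hasSectionThrough_of_isLogSingularity (hX : IsSymmetricNSurface A π s)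
    (hφ : ∀ z, φ (starRingEnd ℂ z) = s (φ z)) (ha : a ∈ E.moved)
    (hy : y ∈ disc a (D.radius a)) (hyE : y ∉ E.base) :
    ∃ N ∈ 𝓝 y, ∀ V, IsLogSingularity π a (D.radius a) V → ∀ x ∈ V, E.map x ∈ N →
      HasSectionThrough E.map N x := by
  have h_nhds (χ) (hχ : χ ∈ ({E.η a, E.ηConj a} : Set (Sphere ≃ₜ Sphere))) :
      ∃ N ∈ 𝓝 y, ∀ V, IsComponentOf (π ⁻¹' (disc a (D.radius a) \ {a})) V →
        (∀ x ∈ V, E.map x = χ (π x)) → ∀ x ∈ V, E.map x ∈ N → HasSectionThrough E.map N x := by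
    refine exists_nhds_hasSectionThrough_of_isComponentOf
      (hX.isCoveringMapOn_disc D (E.moved_subset_base ha))
      ((isOpen_disc _ _).sdiff isClosed_singleton) χ ⟨?_, fun h => hyE ?_⟩
    · rwa [← apply_mem_disc_iff_of_mem_localModels ha (.inr hχ), χ.apply_symm_apply]
    · rw [← χ.apply_symm_apply y, h]
      exact apply_mem_base ha hχ
  choose! N hN h_section using h_nhds
  refine ⟨⋂ χ ∈ ({E.η a, E.ηConj a} : Set (Sphere ≃ₜ Sphere)), N χ,
    (biInter_mem (toFinite _)).2 hN, fun V hV x hxV hx => ?_⟩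
  obtain ⟨χ, hχ, h_map⟩ := exists_model_of_isLogSingularity hX hφ ha hV
  exact (h_section χ hχ V hV.1 h_map x hxV (mem_iInter₂.1 hx χ hχ)).mono
    (biInter_subset_of_mem hχ)

theorem hasSectionThrough_of_forall_notMem (hX : IsNSurface A π) (ha : a ∈ A)
    (hx : π x ∈ disc a (D.radius a))
    (h_log : ∀ V, IsLogSingularity π a (D.radius a) V → x ∉ V)
    (h : HasSectionThrough π (disc a (D.radius a)) x) :
    HasSectionThrough E.map (disc a (D.radius a)) x := by
  obtain ⟨σ, hσ, hπσ, hσx⟩ := h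
  have h_conn : IsPreconnected (disc a (D.radius a)) := by
    obtain ⟨e, he, -, h_range⟩ := exists_disc_chart a (D.radius_pos a ha)
    exact h_range ▸ isPreconnected_range he.continuous
  have h_map (z) (hz : z ∈ disc a (D.radius a)) : E.map (σ z) = z := by
    rw [map_eq_of_forall_notMem ha (by rwa [hπσ z hz]), hπσ z hz]
    refine fun V hV hzV => h_log V hV ?_
    refine (hV.isComponentOf_disc hX ha).subset_of_isPreconnected (h_conn.image σ hσ) ?_
      (mem_image_of_mem σ hz) hzV ⟨π x, hx, hσx⟩
    rintro _ ⟨w, hw, rfl⟩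
    rwa [mem_preimage, hπσ w hw]
  rw [← hσx]
  exact .of_homeomorph (Homeomorph.refl _) hσ h_map (image_id _).superset hx

theorem map_mem_disc_iff (hX : IsSymmetricNSurface A π s)
    (hφ : ∀ z, φ (starRingEnd ℂ z) = s (φ z)) (ha : a ∈ A) :
    E.map x ∈ disc a (D.radius a) ↔ π x ∈ disc a (D.radius a) := by
  obtain ⟨ψ, hψ, h_map⟩ := exists_model (E := E) hX hφ x
  rw [h_map, apply_mem_disc_iff_of_mem_models ha hψ]

theorem isCoveringMapOn_map (hX : IsSymmetricNSurface A π s)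
    (hφ : ∀ z, φ (starRingEnd ℂ z) = s (φ z)) {Q : Set Sphere} (hQ : Q.Finite)
    (hinf : (π ⁻¹' Q).Infinite) : IsCoveringMapOn E.map E.baseᶜ := by
  have := hX.toIsNSurface.t2Space
  refine isCoveringMapOn_of_hasSectionThrough (isLocalHomeomorph_map hX hφ) fun y hy => ?_
  by_cases h : ∃ a ∈ E.moved, y ∈ disc a (D.radius a)
  · obtain ⟨a, ha, hya⟩ := h
    have haA := E.moved_subset_base ha
    obtain ⟨N, hN, h_log⟩ := exists_nhds_hasSectionThrough_of_isLogSingularity hX hφ ha hya hy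
    refine ⟨disc a (D.radius a) ∩ N, inter_mem ((isOpen_disc _ _).mem_nhds hya) hN,
      fun x hx => ?_⟩
    by_cases hxV : ∃ V, IsLogSingularity π a (D.radius a) V ∧ x ∈ V
    · obtain ⟨V, hV, hxV⟩ := hxV
      exact (h_log V hV x hxV hx.2).mono inter_subset_right
    · have hxa := (map_mem_disc_iff hX hφ haA).1 hx.1
      have h_section := (hX.exists_isLogSingularity_or_hasSectionThrough D hQ hinf haA
        hxa).resolve_left hxV
      push Not at hxV
      exact (hasSectionThrough_of_forall_notMem hX.toIsNSurface haA hxa hxV h_section).mono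
        inter_subset_left
  · push Not at h
    exact exists_nhds_hasSectionThrough_of_forall_notMem_disc hX hφ h fun hyA =>
      hy (.inl ⟨hyA, fun hm => h y hm (D.self_mem hyA)⟩)

theorem exists_infinite_preimage (hX : IsSymmetricNSurface A π s)
    (hφ : ∀ z, φ (starRingEnd ℂ z) = s (φ z)) {Q : Set Sphere} (hQ : Q.Finite)
    (hinf : (E.map ⁻¹' Q).Infinite) : ∃ Q' : Set Sphere, Q'.Finite ∧ (π ⁻¹' Q').Infinite := by
  refine ⟨⋃ ψ ∈ E.models, ψ ⁻¹' Q, (finite_models hX.finite_base).biUnion fun ψ _ =>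
    hQ.preimage ψ.injective.injOn, hinf.mono fun x hx => ?_⟩
  obtain ⟨ψ, hψ, h_map⟩ := exists_model (E := E) hX hφ x
  exact mem_iUnion₂.2 ⟨ψ, hψ, by rwa [mem_preimage, ← h_map]⟩

theorem map_eq_iff_of_notMem_moved (hX : IsSymmetricNSurface A π s)
    (hφ : ∀ z, φ (starRingEnd ℂ z) = s (φ z)) {b : Sphere} (hb : b ∈ A) (hbE : b ∉ E.moved) :
    E.map x = b ↔ π x = b := by
  obtain ⟨ψ, hψ, h_map⟩ := exists_model (E := E) hX hφ x
  have hψb : ψ b = b := hψ.2 b fun a ha hba =>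
    hbE (D.eq_of_mem hb (E.moved_subset_base ha) (D.self_mem hb) hba ▸ ha)
  rw [h_map, ← ψ.injective.eq_iff (a := π x), hψb]

end Deformation

end Deformation

section BaseGraph

theorem reflection_unitPt (θ : ℝ) : reflection (unitPt θ) = unitPt θ := by
  rw [unitPt, reflection_coe (Complex.exp_ne_zero _), ← Complex.exp_neg, ← Complex.exp_conj]
  simp

theorem reflection_mem_openRay {θ : ℝ} {y : Sphere} (hy : y ∈ openRay θ) :
    reflection y ∈ openRay θ := by
  obtain ⟨t, ht, rfl⟩ := hy
  refine ⟨t⁻¹, inv_pos.2 ht, ?_⟩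
  rw [reflection_coe (mul_ne_zero (by exact_mod_cast ht.ne') (Complex.exp_ne_zero _)), mul_inv,
    map_mul, ← Complex.exp_neg, ← Complex.exp_conj]
  simp

theorem reflection_image_openRay (θ : ℝ) : reflection '' openRay θ = openRay θ :=
  Subset.antisymm (image_subset_iff.2 fun _ => reflection_mem_openRay) fun y hy =>
    ⟨reflection y, reflection_mem_openRay hy, reflection_reflection y⟩

namespace SymmetricBaseGraph

variable {B : Set Sphere} (G : SymmetricBaseGraph B)

/-- The logarithmic coordinate on the sphere minus `×` and `∘`: the arcs of the base graph become
horizontal lines, the base curve becomes the imaginary axis, and `×` lies at `re w = -∞`. -/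
noncomputable def pt (w : ℂ) : Sphere := G.h ((Complex.exp w : ℂ) : Sphere)

theorem continuous_pt : Continuous G.pt :=
  G.h.continuous.comp (OnePoint.continuous_coe.comp Complex.continuous_exp)

theorem isOpenMap_pt : IsOpenMap G.pt :=
  G.h.isOpenMap.comp (OnePoint.isOpenEmbedding_coe.isOpenMap.comp Complex.isOpenMap_exp)

theorem h_coe_eq_pt_iff {z w : ℂ} : G.h (z : Sphere) = G.pt w ↔ z = Complex.exp w := by
  rw [pt, G.h.injective.eq_iff, OnePoint.coe_injective.eq_iff]

theorem pt_eq_pt_iff {w z : ℂ} :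
    G.pt w = G.pt z ↔ w.re = z.re ∧ (w.im : Real.Angle) = z.im := by
  rw [pt, h_coe_eq_pt_iff, Complex.exp_eq_exp_iff_exists_int,
    Real.Angle.angle_eq_iff_two_pi_dvd_sub]
  simp only [Complex.ext_iff, Complex.add_re, Complex.add_im]
  simp [sub_eq_iff_eq_add', mul_comm]

theorem pt_injOn (L : ℝ) : InjOn G.pt {w | w.im ∈ Ico L (L + 2 * Real.pi)} := by
  intro w hw z hz h
  have : Fact (0 < 2 * Real.pi) := ⟨Real.two_pi_pos⟩
  obtain ⟨h_re, h_im⟩ := G.pt_eq_pt_iff.1 h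
  exact Complex.ext h_re ((AddCircle.coe_eq_coe_iff_of_mem_Ico hw hz).1 h_im)

theorem pt_ne_cross (w : ℂ) : G.pt w ≠ G.cross := fun h =>
  Complex.exp_ne_zero w (OnePoint.coe_injective (G.h.injective h))

theorem pt_ne_circ (w : ℂ) : G.pt w ≠ G.circ := fun h =>
  OnePoint.coe_ne_infty _ (G.h.injective h)

theorem exists_pt_eq {y : Sphere} (h_cross : y ≠ G.cross) (h_circ : y ≠ G.circ) (L : ℝ) :
    ∃ w : ℂ, w.im ∈ Ico L (L + 2 * Real.pi) ∧ G.pt w = y := by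
  obtain ⟨z, rfl⟩ := G.h.surjective y
  induction z using OnePoint.rec with
  | infty => exact absurd rfl h_circ
  | coe z =>
    have hz : z ≠ 0 := by
      rintro rfl
      exact h_cross rfl
    refine ⟨⟨Real.log ‖z‖, toIcoMod Real.two_pi_pos L z.arg⟩, toIcoMod_mem_Ico _ _ _, ?_⟩
    refine Eq.trans (G.pt_eq_pt_iff (z := Complex.log z).2 ⟨(Complex.log_re z).symm,
      (Real.Angle.coe_toIcoMod _ _).trans (by rw [Complex.log_im])⟩) ?_
    rw [pt, Complex.exp_log hz]

/-- The angles of the arcs of the base graph, modulo `2π`. -/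
def edgeAngles : Set ℝ := {θ | ∃ j, (θ : Real.Angle) = G.β j}

/-- The angles of the base points, modulo `2π`. -/
def baseAngles : Set ℝ := {θ | ∃ j : Fin G.q, (θ : Real.Angle) = G.α j.castSucc}

theorem h_coe_real_mul_exp {t : ℝ} (ht : 0 < t) (w : ℂ) :
    G.h ((t * Complex.exp w : ℂ) : Sphere) = G.pt (Real.log t + w) := by
  rw [h_coe_eq_pt_iff, Complex.exp_add, ← Complex.ofReal_exp, Real.exp_log ht]

theorem pt_mem_openEdges_iff {w : ℂ} : G.pt w ∈ G.openEdges ↔ w.im ∈ G.edgeAngles := by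
  simp only [openEdges, mem_iUnion, edgeAngles, mem_ofPred_eq]
  refine exists_congr fun j => ⟨?_, fun h => ?_⟩
  · rintro ⟨_, ⟨t, ht, rfl⟩, h⟩
    rw [h_coe_real_mul_exp _ ht] at h
    simpa using (G.pt_eq_pt_iff.1 h).2.symm
  · refine ⟨_, ⟨Real.exp w.re, Real.exp_pos _, rfl⟩, ?_⟩
    rw [h_coe_real_mul_exp _ (Real.exp_pos _), Real.log_exp, pt_eq_pt_iff]
    simpa using h.symm

theorem mem_base_iff {b : Sphere} : b ∈ B ↔ ∃ j : Fin G.q, G.h (unitPt (G.α j.castSucc)) = b :=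
  (Set.ext_iff.1 G.base_eq b).symm

theorem pt_mem_base_iff {w : ℂ} : G.pt w ∈ B ↔ w.re = 0 ∧ w.im ∈ G.baseAngles := by
  have h_unit (θ : ℝ) : G.h (unitPt θ) = G.pt w ↔ w.re = 0 ∧ (w.im : Real.Angle) = θ := by
    rw [unitPt, ← pt, pt_eq_pt_iff]
    simp [eq_comm]
  simp [G.mem_base_iff, baseAngles, h_unit]

theorem cross_notMem_base : G.cross ∉ B := by
  rw [G.mem_base_iff]
  rintro ⟨j, hj⟩
  exact G.pt_ne_cross _ hj

theorem isClosed_edgeAngles : IsClosed G.edgeAngles := by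
  have h : G.edgeAngles = (↑) ⁻¹' range fun j => (G.β j : Real.Angle) := by
    ext
    simp [edgeAngles, eq_comm]
  rw [h]
  exact (finite_range _).isClosed.preimage Real.Angle.continuous_coe

theorem add_mem_edgeAngles {θ : ℝ} (h : θ ∈ G.edgeAngles) (n : ℤ) :
    θ + n * (2 * Real.pi) ∈ G.edgeAngles := by
  obtain ⟨j, hj⟩ := h
  exact ⟨j, by rw [← hj, Real.Angle.angle_eq_iff_two_pi_dvd_sub]; exact ⟨n, by ring⟩⟩

theorem β_mem_edgeAngles (j : Fin G.q) : G.β j ∈ G.edgeAngles := ⟨j, rfl⟩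

theorem exists_eq_add_of_mem_baseAngles {θ : ℝ} (h : θ ∈ G.baseAngles) :
    ∃ (j : Fin G.q) (n : ℤ), θ = G.α j.castSucc + n * (2 * Real.pi) := by
  obtain ⟨j, hj⟩ := h
  obtain ⟨n, hn⟩ := Real.Angle.angle_eq_iff_two_pi_dvd_sub.1 hj
  exact ⟨j, n, by linarith⟩

theorem notMem_Ioo_of_mem_baseAngles {θ : ℝ} (h : θ ∈ G.baseAngles) (j : Fin G.q) :
    θ ∉ Ioo (G.α j.castSucc) (G.α j.succ) := by
  obtain ⟨k, n, rfl⟩ := G.exists_eq_add_of_mem_baseAngles h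
  rintro ⟨h_left, h_right⟩
  have hα_mem (i : Fin (G.q + 1)) : G.α i ∈ Icc (G.α 0) (G.α 0 + 2 * Real.pi) :=
    ⟨G.α_strictMono.monotone (Fin.zero_le i),
      G.α_last ▸ G.α_strictMono.monotone (Fin.le_last i)⟩
  have hαk : G.α k.castSucc < G.α 0 + 2 * Real.pi :=
    G.α_last ▸ G.α_strictMono (Fin.castSucc_lt_last k)
  have hn_lt : n < 1 := by
    have : (n : ℝ) * (2 * Real.pi) < 1 * (2 * Real.pi) := by
      linarith [(hα_mem k.castSucc).1, (hα_mem j.succ).2]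
    exact_mod_cast lt_of_mul_lt_mul_right this Real.two_pi_pos.le
  have hn_gt : -1 < n := by
    have : (-1 : ℝ) * (2 * Real.pi) < n * (2 * Real.pi) := by linarith [(hα_mem j.castSucc).1]
    exact_mod_cast lt_of_mul_lt_mul_right this Real.two_pi_pos.le
  obtain rfl : n = 0 := by omega
  simp only [Int.cast_zero, zero_mul, add_zero, G.α_strictMono.lt_iff_lt, Fin.lt_def,
    Fin.val_castSucc, Fin.val_succ] at h_left h_right
  omega

theorem notMem_edgeAngles_of_mem_baseAngles {θ : ℝ} (h : θ ∈ G.baseAngles) :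
    θ ∉ G.edgeAngles := by
  rintro ⟨j, hj⟩
  obtain ⟨k, hk⟩ := h
  exact G.notMem_Ioo_of_mem_baseAngles ⟨k, hj.symm.trans hk⟩ j (G.β_mem j)

theorem notMem_base_of_mem_openEdges {w : ℂ} (h : G.pt w ∈ G.openEdges) : G.pt w ∉ B := fun hB =>
  G.notMem_edgeAngles_of_mem_baseAngles (G.pt_mem_base_iff.1 hB).2 (G.pt_mem_openEdges_iff.1 h)

theorem exists_edgeAngle_between {θ θ' : ℝ} (h : θ ∈ G.baseAngles) (h' : θ' ∈ G.baseAngles)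
    (hlt : θ < θ') : ∃ γ ∈ G.edgeAngles, γ ∈ Ioo θ θ' := by
  obtain ⟨j, n, rfl⟩ := G.exists_eq_add_of_mem_baseAngles h
  obtain ⟨hβ_left, hβ_right⟩ := G.β_mem j
  refine ⟨_, G.add_mem_edgeAngles (G.β_mem_edgeAngles j) n, by linarith, ?_⟩
  obtain ⟨k, m, rfl⟩ := G.exists_eq_add_of_mem_baseAngles h'
  have h_notMem := G.notMem_Ioo_of_mem_baseAngles
    (θ := G.α k.castSucc + (m - n : ℤ) * (2 * Real.pi))
    ⟨k, Real.Angle.angle_eq_iff_two_pi_dvd_sub.2 ⟨m - n, by ring⟩⟩ j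
  push_cast at h_notMem
  by_contra! hle
  exact h_notMem ⟨by linarith, by linarith⟩

/-- `(L, R)` is the interval of angles of the face of the base graph that contains the base point
of angle `α`. -/
structure IsSector (L α R : ℝ) : Prop where
  left_lt : L < α
  lt_right : α < R
  left_mem : L ∈ G.edgeAngles
  right_mem : R ∈ G.edgeAngles
  mem_baseAngles : α ∈ G.baseAngles
  notMem_edgeAngles : ∀ θ ∈ Ioo L R, θ ∉ G.edgeAngles

theorem exists_isSector_of_mem_baseAngles {α : ℝ} (hα : α ∈ G.baseAngles) :
    ∃ L R, G.IsSector L α R := by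
  have hα_edge := G.notMem_edgeAngles_of_mem_baseAngles hα
  obtain ⟨j, n, h_eq⟩ := G.exists_eq_add_of_mem_baseAngles hα
  have h_period : G.α j.succ ≤ G.α j.castSucc + 2 * Real.pi := by
    have h_last := G.α_last ▸ G.α_strictMono.monotone (Fin.le_last j.succ)
    linarith [G.α_strictMono.monotone (Fin.zero_le j.castSucc)]
  obtain ⟨hβ_left, hβ_right⟩ := G.β_mem j
  have hβ := G.β_mem_edgeAngles j
  obtain ⟨L, ⟨hL, hL_mem⟩, hL_max⟩ :=
    (isCompact_Icc.inter_left G.isClosed_edgeAngles).exists_isGreatest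
      (s := G.edgeAngles ∩ Icc (α - 2 * Real.pi) α)
      ⟨_, G.add_mem_edgeAngles hβ (n - 1), by push_cast; constructor <;> linarith⟩
  obtain ⟨R, ⟨hR, hR_mem⟩, hR_min⟩ :=
    (isCompact_Icc.inter_left G.isClosed_edgeAngles).exists_isLeast
      (s := G.edgeAngles ∩ Icc α (α + 2 * Real.pi))
      ⟨_, G.add_mem_edgeAngles hβ n, by constructor <;> linarith⟩
  refine ⟨L, R, hL_mem.2.lt_of_ne fun h => hα_edge (h ▸ hL),
    hR_mem.1.lt_of_ne fun h => hα_edge (h.symm ▸ hR), hL, hR, hα, fun θ hθ h => ?_⟩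
  rcases le_total θ α with hle | hle
  · exact hθ.1.not_ge (hL_max ⟨h, hL_mem.1.trans hθ.1.le, hle⟩)
  · exact hθ.2.not_ge (hR_min ⟨h, hle, hθ.2.le.trans hR_mem.2⟩)

theorem exists_isSector {b : Sphere} (hb : b ∈ B) :
    ∃ L α R, G.IsSector L α R ∧ G.pt ⟨0, α⟩ = b := by
  obtain ⟨j, rfl⟩ := G.mem_base_iff.1 hb
  obtain ⟨L, R, hS⟩ := G.exists_isSector_of_mem_baseAngles ⟨j, rfl⟩
  exact ⟨L, _, R, hS, by simp [pt, unitPt, Complex.mk_eq_add_mul_I]⟩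

theorem isOpen_pt_image_strip (a b : ℝ) : IsOpen (G.pt '' {w | w.im ∈ Ioo a b}) :=
  G.isOpenMap_pt _ (isOpen_Ioo.preimage Complex.continuous_im)

theorem pt_notMem_graph {w : ℂ} (h : w.im ∉ G.edgeAngles) : G.pt w ∉ G.graph := by
  rintro ((h_cross | h_circ) | h_edge)
  · exact G.pt_ne_cross _ h_cross
  · exact G.pt_ne_circ _ h_circ
  · exact h (G.pt_mem_openEdges_iff.1 h_edge)

namespace IsSector

variable {G} {L α R : ℝ} (hS : G.IsSector L α R)
include hS

theorem width : R ≤ L + 2 * Real.pi := by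
  by_contra! h
  have h_mem := G.add_mem_edgeAngles hS.left_mem 1
  rw [Int.cast_one, one_mul] at h_mem
  exact hS.notMem_edgeAngles _ ⟨by linarith [Real.two_pi_pos], h⟩ h_mem

theorem mem_Ioo : α ∈ Ioo L R := ⟨hS.left_lt, hS.lt_right⟩

theorem eq_of_pt_mem_base {w : ℂ} (hw : w.im ∈ Ioo L R) (h : G.pt w ∈ B) : w = ⟨0, α⟩ := by
  obtain ⟨h_re, h_im⟩ := G.pt_mem_base_iff.1 h
  refine Complex.ext h_re ?_
  by_contra hne
  rcases lt_or_gt_of_ne hne with hlt | hlt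
  · obtain ⟨γ, hγ, hγ_mem⟩ := G.exists_edgeAngle_between h_im hS.mem_baseAngles hlt
    exact hS.notMem_edgeAngles γ ⟨hw.1.trans hγ_mem.1, hγ_mem.2.trans hS.lt_right⟩ hγ
  · obtain ⟨γ, hγ, hγ_mem⟩ := G.exists_edgeAngle_between hS.mem_baseAngles h_im hlt
    exact hS.notMem_edgeAngles γ ⟨hS.left_lt.trans hγ_mem.1, hγ_mem.2.trans hw.2⟩ hγ

theorem closure_pt_image_strip_subset :
    closure (G.pt '' {w | w.im ∈ Ioo L R}) ∩ G.graphᶜ ⊆ G.pt '' {w | w.im ∈ Ioo L R} := by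
  rintro y ⟨hy, hyG⟩
  obtain ⟨w, hw, rfl⟩ := G.exists_pt_eq (fun h => hyG (Or.inl (Or.inl h)))
    (fun h => hyG (Or.inl (Or.inr h))) L
  have h_im {θ : ℝ} (hθ : θ ∈ G.edgeAngles) : θ ≠ w.im := fun h =>
    hyG (Or.inr (G.pt_mem_openEdges_iff.2 (h ▸ hθ)))
  have hLw : L < w.im := hw.1.lt_of_ne (h_im hS.left_mem)
  by_contra h_notMem
  have hRw : R < w.im :=
    (not_lt.1 fun h => h_notMem ⟨w, ⟨hLw, h⟩, rfl⟩).lt_of_ne (h_im hS.right_mem)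
  obtain ⟨_, ⟨v, hv, rfl⟩, u, hu, huv⟩ := mem_closure_iff.1 hy _
    (G.isOpen_pt_image_strip R (L + 2 * Real.pi)) ⟨w, ⟨hRw, hw.2⟩, rfl⟩
  obtain rfl : u = v := G.pt_injOn L ⟨hu.1.le, hu.2.trans_le hS.width⟩
    ⟨((hS.left_lt.trans hS.lt_right).trans hv.1).le, hv.2⟩ huv
  exact lt_asymm hv.1 hu.2

theorem connectedComponentIn_eq :
    connectedComponentIn G.graphᶜ (G.pt ⟨0, α⟩) = G.pt '' {w | w.im ∈ Ioo L R} := by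
  have h_convex : Convex ℝ {w : ℂ | w.im ∈ Ioo L R} :=
    (convex_halfSpace_im_gt L).inter (convex_halfSpace_im_lt R)
  refine connectedComponentIn_eq_of_isOpen
    (h_convex.isPreconnected.image _ G.continuous_pt.continuousOn) (G.isOpen_pt_image_strip L R)
    ⟨_, hS.mem_Ioo, rfl⟩ ?_ hS.closure_pt_image_strip_subset
  rintro _ ⟨w, hw, rfl⟩
  exact G.pt_notMem_graph (hS.notMem_edgeAngles _ hw)

theorem pt_mem_connectedComponentIn (t : ℝ) :
    G.pt ⟨t, α⟩ ∈ connectedComponentIn G.graphᶜ (G.pt ⟨0, α⟩) := by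
  rw [hS.connectedComponentIn_eq]
  exact ⟨_, hS.mem_Ioo, rfl⟩

theorem connectedComponentIn_diff_subset :
    connectedComponentIn G.graphᶜ (G.pt ⟨0, α⟩) \ {G.pt ⟨0, α⟩} ⊆ Bᶜ := by
  rw [hS.connectedComponentIn_eq]
  rintro _ ⟨⟨w, hw, rfl⟩, hne⟩ hB
  exact hne (congrArg G.pt (hS.eq_of_pt_mem_base hw hB))

theorem pt_notMem_base {t : ℝ} (ht : t ≠ 0) : G.pt ⟨t, α⟩ ∉ B := fun h =>
  ht (congrArg Complex.re (hS.eq_of_pt_mem_base hS.mem_Ioo h))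

theorem exists_strip_chart : ∃ k : ℂ → ℂ, IsOpenEmbedding k ∧ (∀ t : ℝ, k t = ⟨-t, α⟩) ∧
    range k = {w | w.im ∈ Ioo L R} := by
  have hLR : L < R := hS.left_lt.trans hS.lt_right
  let g := OpenPartialHomeomorph.univBall ((L + R) / 2 : ℝ) ((R - L) / 2)
  have hg : IsOpenEmbedding g := g.isOpenEmbedding (OpenPartialHomeomorph.univBall_source _ _)
  have hg_range : range g = Ioo L R := by
    rw [← image_univ, ← OpenPartialHomeomorph.univBall_source ((L + R) / 2 : ℝ) ((R - L) / 2),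
      g.image_source_eq_target, OpenPartialHomeomorph.univBall_target _ (by linarith),
      Real.ball_eq_Ioo]
    congr 1 <;> ring
  obtain ⟨y₀, hy₀⟩ : α ∈ range g := hg_range ▸ hS.mem_Ioo
  have hk : IsOpenEmbedding fun w : ℂ => (⟨-w.re, g (w.im + y₀)⟩ : ℂ) :=
    Complex.equivRealProdCLM.symm.toHomeomorph.isOpenEmbedding.comp
      (((Homeomorph.neg ℝ).isOpenEmbedding.prodMap
        (hg.comp (Homeomorph.addRight y₀).isOpenEmbedding)).comp
        Complex.equivRealProdCLM.toHomeomorph.isOpenEmbedding)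
  refine ⟨_, hk, fun t => by simp [hy₀], ?_⟩
  ext w
  simp only [mem_range, mem_ofPred_eq, ← hg_range]
  constructor
  · rintro ⟨z, rfl⟩
    exact ⟨_, rfl⟩
  · rintro ⟨y, hy⟩
    exact ⟨⟨-w.re, y - y₀⟩, by simp [hy]⟩

theorem exists_chart : ∃ e : ℂ → Sphere, IsOpenEmbedding e ∧ (∀ t : ℝ, e t = G.pt ⟨-t, α⟩) ∧
    range e = connectedComponentIn G.graphᶜ (G.pt ⟨0, α⟩) := by
  obtain ⟨k, hk, hkt, hk_range⟩ := hS.exists_strip_chart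
  have h_inj : Function.Injective (G.pt ∘ k) := fun w z h => by
    have h_mem (u : ℂ) : (k u).im ∈ Ico L (L + 2 * Real.pi) := by
      have hu : k u ∈ {w : ℂ | w.im ∈ Ioo L R} := hk_range ▸ mem_range_self u
      exact ⟨hu.1.le, hu.2.trans_le hS.width⟩
    exact hk.injective (G.pt_injOn L (h_mem w) (h_mem z) h)
  refine ⟨G.pt ∘ k, .of_continuous_injective_isOpenMap (G.continuous_pt.comp hk.continuous) h_inj
    (G.isOpenMap_pt.comp hk.isOpenMap), fun t => congrArg G.pt (hkt t), ?_⟩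
  rw [range_comp, hk_range, hS.connectedComponentIn_eq]

end IsSector

theorem base_subset_compl_graph : B ⊆ G.graphᶜ := by
  intro b hb
  obtain ⟨L, α, R, hS, rfl⟩ := G.exists_isSector hb
  exact G.pt_notMem_graph (hS.notMem_edgeAngles _ hS.mem_Ioo)

theorem conj_cross : conj G.cross = G.cross := by
  rw [cross, ← G.h_conj, conj_coe, map_zero]

theorem conj_circ : conj G.circ = G.circ := by
  rw [circ, ← G.h_conj]; rfl

theorem image_conj_graph : conj '' G.graph = G.graph := by
  rw [graph, image_union, image_insert_eq, image_singleton, conj_cross, conj_circ, openEdges,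
    G.symm]

theorem image_conj_connectedComponentIn {b : Sphere} (hb : b ∈ B) (hb_conj : conj b = b) :
    conj '' connectedComponentIn G.graphᶜ b = connectedComponentIn G.graphᶜ b := by
  have h_bij : Function.Bijective conj := conjHomeo.bijective
  have h := conjHomeo.image_connectedComponentIn (G.base_subset_compl_graph hb)
  change conj '' _ = connectedComponentIn (conj '' _) (conj b) at h
  rwa [image_compl_eq h_bij, G.image_conj_graph, hb_conj] at h

theorem image_reflection_trans_openRay (θ : ℝ) :
    reflectionHomeo.trans G.h '' openRay θ = G.h '' openRay θ := by
  conv_rhs => rw [← reflection_image_openRay, image_image]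
  rfl

/-- The base graph with the vertices `×` and `∘` exchanged. -/
noncomputable def flip : SymmetricBaseGraph B where
  __ := G
  h := reflectionHomeo.trans G.h
  h_conj y := by
    rw [Homeomorph.trans_apply, Homeomorph.trans_apply, reflectionHomeo_apply, reflection_conj,
      G.h_conj, reflectionHomeo_apply]
  base_eq := by
    simp only [Homeomorph.trans_apply, reflectionHomeo_apply, reflection_unitPt]
    exact G.base_eq
  symm := by
    simp only [image_reflection_trans_openRay]
    exact G.symm

theorem flip_cross : G.flip.cross = G.circ := by
  simp [flip, cross, circ, reflection]

theorem flip_circ : G.flip.circ = G.cross := by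
  simp [flip, cross, circ, reflection]

theorem flip_openEdges : G.flip.openEdges = G.openEdges :=
  iUnion_congr fun j => G.image_reflection_trans_openRay (G.β j)

theorem flip_graph : G.flip.graph = G.graph := by
  rw [graph, graph, flip_openEdges, flip_cross, flip_circ, pair_comm]

end SymmetricBaseGraph

end BaseGraph

section Rays

theorem eventually_eq_of_tendsto {X Y Z : Type*} [TopologicalSpace X] {p : X → Y} {l : Filter Z}
    {U U' : Z → X} {v : X} (hp : IsLocallyInjective p) (hU : Tendsto U l (𝓝 v))
    (hU' : Tendsto U' l (𝓝 v)) (h : ∀ᶠ t in l, p (U t) = p (U' t)) : ∀ᶠ t in l, U t = U' t := by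
  obtain ⟨W, hW, h_inj⟩ := isLocallyInjective_iff_nhds.1 hp v
  filter_upwards [hU hW, hU' hW, h] with t ht ht' h_eq using h_inj ht ht' h_eq

namespace SymmetricBaseGraph

variable {X : Type*} [TopologicalSpace X] {p : X → Sphere} {B : Set Sphere}

theorem hasBasis_nhds_cross (G : SymmetricBaseGraph B) : (𝓝 G.cross).HasBasis (fun _ : ℝ => True)
    fun T => insert G.cross (G.pt '' {w | w.re < T}) := by
  have he : IsOpenEmbedding fun z : ℂ => G.h (z : Sphere) :=
    G.h.isOpenEmbedding.comp OnePoint.isOpenEmbedding_coe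
  have h_ball (T : ℝ) : (fun z : ℂ => G.h (z : Sphere)) '' Metric.ball 0 (Real.exp T) =
      insert G.cross (G.pt '' {w | w.re < T}) := by
    have h_exp : Metric.ball (0 : ℂ) (Real.exp T) = insert 0 (Complex.exp '' {w | w.re < T}) := by
      ext z
      rcases eq_or_ne z 0 with rfl | hz
      · simp [Real.exp_pos]
      · rw [mem_ball_zero_iff, mem_insert_iff, or_iff_right hz]
        refine ⟨fun h => ⟨Complex.log z, ?_, Complex.exp_log hz⟩, ?_⟩
        · rwa [mem_ofPred_eq, Complex.log_re, Real.log_lt_iff_lt_exp (norm_pos_iff.2 hz)]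
        · rintro ⟨w, hw, rfl⟩
          rwa [Complex.norm_exp, Real.exp_lt_exp]
    rw [h_exp, image_insert_eq, image_image]
    rfl
  have h_basis : (𝓝 (0 : ℂ)).HasBasis (fun _ : ℝ => True) fun T => Metric.ball 0 (Real.exp T) :=
    Metric.nhds_basis_ball.to_hasBasis
      (fun ε hε => ⟨Real.log ε, trivial, by rw [Real.exp_log hε]⟩)
      fun T _ => ⟨Real.exp T, Real.exp_pos T, Subset.rfl⟩
  have h_nhds : map (fun z : ℂ => G.h (z : Sphere)) (𝓝 0) = 𝓝 G.cross := he.map_nhds_eq 0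
  rw [← h_nhds]
  simpa only [h_ball] using h_basis.map fun z : ℂ => G.h (z : Sphere)

variable {G : SymmetricBaseGraph B} {u v : X} {t₀ θ : ℝ}

theorem tendsto_pt_atBot (θ : ℝ) : Tendsto (fun t : ℝ => G.pt ⟨t, θ⟩) atBot (𝓝 G.cross) :=
  G.hasBasis_nhds_cross.tendsto_right_iff.2 fun T _ =>
    (eventually_lt_atBot T).mono fun _ ht => Or.inr ⟨_, ht, rfl⟩

theorem exists_section_cross (hp : IsLocalHomeomorph p) (hv : p v = G.cross) {W : Set X}
    (hW : W ∈ 𝓝 v) : ∃ (T : ℝ) (σ : ℂ → X), ContinuousOn σ {w | w.re < T} ∧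
      (∀ w, w.re < T → σ w ∈ W ∧ p (σ w) = G.pt w) ∧
      (∀ᶠ u in 𝓝 v, ∀ w, p u = G.pt w → w.re < T ∧ σ w = u) ∧
      ∀ θ : ℝ, Tendsto (fun t : ℝ => σ ⟨t, θ⟩) atBot (𝓝 v) := by
  obtain ⟨q, hvq, rfl⟩ := hp v
  have h_cross : G.cross ∈ q.target := hv ▸ q.map_source hvq
  have hq_symm : q.symm G.cross = v := by rw [← hv, q.left_inv hvq]
  have h_tendsto : Tendsto q.symm (𝓝 G.cross) (𝓝 v) := by
    simpa only [hq_symm] using (q.continuousAt_symm h_cross).tendsto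
  obtain ⟨T, -, hT⟩ := G.hasBasis_nhds_cross.mem_iff.1
    (Filter.inter_mem (q.open_target.mem_nhds h_cross) (h_tendsto hW))
  have hT_mem (w : ℂ) (hw : w.re < T) : G.pt w ∈ q.target ∩ q.symm ⁻¹' W :=
    hT (Or.inr ⟨w, hw, rfl⟩)
  refine ⟨T, fun w => q.symm (G.pt w),
    q.continuousOn_symm.comp G.continuous_pt.continuousOn fun w hw => (hT_mem w hw).1,
    fun w hw => ⟨(hT_mem w hw).2, q.right_inv (hT_mem w hw).1⟩, ?_,
    fun θ => h_tendsto.comp (G.tendsto_pt_atBot θ)⟩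
  have h_near : ∀ᶠ u in 𝓝 v, q u ∈ insert G.cross (G.pt '' {w | w.re < T}) :=
    (q.continuousAt hvq).eventually (hv ▸ G.hasBasis_nhds_cross.mem_of_mem trivial)
  filter_upwards [h_near, q.open_source.mem_nhds hvq] with u hu huq w hw
  rw [hw] at hu
  obtain ⟨z, hz, hzw⟩ := hu.resolve_left (G.pt_ne_cross w)
  exact ⟨(G.pt_eq_pt_iff.1 hzw).1 ▸ hz, by rw [← hw, q.left_inv huq]⟩

theorem exists_ray_lift (hp : IsCoveringMapOn p Bᶜ) (hu : p u = G.pt ⟨t₀, θ⟩)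
    (hB : ∀ t ≤ t₀, G.pt ⟨t, θ⟩ ∉ B) :
    ∃ (U : C(ℝ, X)) (v : X), U t₀ = u ∧ (∀ t, p (U t) = G.pt ⟨min t t₀, θ⟩) ∧
      p v = G.cross ∧ Tendsto U atBot (𝓝 v) := by
  let γ (τ : ℝ) : Sphere := G.h (((min |τ| 1 : ℝ) * Complex.exp ⟨t₀, θ⟩ : ℂ) : Sphere)
  have hγ_zero : γ 0 = G.cross := by simp [γ, cross]
  have hγ_exp (t : ℝ) : γ (Real.exp (t - t₀)) = G.pt ⟨min t t₀, θ⟩ := by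
    have h_min : min |Real.exp (t - t₀)| 1 = Real.exp (min t t₀ - t₀) := by
      rw [Real.abs_exp, ← Real.exp_zero, ← Real.exp_monotone.map_min, ← sub_self t₀,
        ← min_sub_sub_right]
    rw [show γ _ = _ from G.h_coe_real_mul_exp (h_min ▸ Real.exp_pos _) _, h_min, Real.log_exp]
    congr 1
    apply Complex.ext <;> simp
  have hγ_notMem (τ : ℝ) : γ τ ∈ Bᶜ := by
    rcases eq_or_ne τ 0 with rfl | hτ
    · rw [hγ_zero]
      exact G.cross_notMem_base
    · have h_abs : γ τ = γ (Real.exp (Real.log |τ| + t₀ - t₀)) := by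
        rw [add_sub_cancel_right, Real.exp_log (abs_pos.2 hτ)]
        simp only [γ, abs_abs]
      rw [h_abs, hγ_exp]
      exact hB _ (min_le_right _ _)
  have hγ : Continuous γ := G.h.continuous.comp (OnePoint.continuous_coe.comp (by fun_prop))
  obtain ⟨Γ, hΓ, hpΓ⟩ := exists_lift hp hγ hγ_notMem (a := Real.exp (t₀ - t₀)) (x := u)
    (by rw [hγ_exp, min_self, hu])
  refine ⟨⟨fun t => Γ (Real.exp (t - t₀)), by fun_prop⟩, Γ 0, hΓ,
    fun t => (hpΓ _).trans (hγ_exp t), (hpΓ 0).trans hγ_zero, ?_⟩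
  exact (Γ.continuous.tendsto 0).comp
    (Real.tendsto_exp_atBot.comp (tendsto_atBot_add_const_right _ _ tendsto_id))

theorem exists_ray_lift_mem (hp : IsCoveringMapOn p Bᶜ) {T : Set Sphere} {C : Set X}
    (hC : IsComponentOf (p ⁻¹' T) C) (hu : p u = G.pt ⟨t₀, θ⟩) (huC : u ∈ C)
    (hB : ∀ t ≤ t₀, G.pt ⟨t, θ⟩ ∉ B) (hT : ∀ t, G.pt ⟨t, θ⟩ ∈ T) :
    ∃ (U : C(ℝ, X)) (v : X), U t₀ = u ∧ (∀ t, U t ∈ C) ∧ (∀ t, p (U t) = G.pt ⟨min t t₀, θ⟩) ∧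
      p v = G.cross ∧ Tendsto U atBot (𝓝 v) := by
  obtain ⟨U, v, hU, hpU, hv, h_tendsto⟩ := exists_ray_lift hp hu hB
  have hUT (t : ℝ) : U t ∈ p ⁻¹' T := by
    rw [mem_preimage, hpU]
    exact hT _
  exact ⟨U, v, hU, hC.mem_of_continuous U.continuous hUT (hU ▸ huC), hpU, hv, h_tendsto⟩

end SymmetricBaseGraph

end Rays

section Faces

namespace SymmetricBaseGraph

variable {X : Type*} [TopologicalSpace X] {p : X → Sphere} {B : Set Sphere}
  {G : SymmetricBaseGraph B} {b : Sphere} {L α R t₀ : ℝ} {F F' : Set X} {u v x : X}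

/-- `F` is a face with label `b` of the preimage of the base graph under `p`. -/
def IsFaceOver (G : SymmetricBaseGraph B) (p : X → Sphere) (b : Sphere) (F : Set X) : Prop :=
  IsComponentOf (p ⁻¹' connectedComponentIn G.graphᶜ b) F

theorem isFaceOver_flip_iff : G.flip.IsFaceOver p b F ↔ G.IsFaceOver p b F := by
  rw [IsFaceOver, flip_graph, IsFaceOver]

theorem exists_isFaceOver (hp : IsLocalHomeomorph p) (hb : b ∈ B) (hv : p v = G.cross) :
    ∃ F, G.IsFaceOver p b F ∧ v ∈ closure F := by
  obtain ⟨L, α, R, hS, rfl⟩ := G.exists_isSector hb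
  obtain ⟨T, σ, hσ, hpσ, -, h_tendsto⟩ := exists_section_cross hp hv univ_mem
  have h_conv : Convex ℝ {w : ℂ | w.re < T ∧ w.im ∈ Ioo L R} :=
    (convex_halfSpace_re_lt T).inter ((convex_halfSpace_im_gt L).inter (convex_halfSpace_im_lt R))
  have hσ_mem {w : ℂ} (hw : w.re < T ∧ w.im ∈ Ioo L R) :
      σ w ∈ p ⁻¹' connectedComponentIn G.graphᶜ (G.pt ⟨0, α⟩) := by
    rw [mem_preimage, (hpσ w hw.1).2, hS.connectedComponentIn_eq]
    exact ⟨w, hw.2, rfl⟩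
  have h_mem {t : ℝ} (ht : t < T) : (⟨t, α⟩ : ℂ).re < T ∧ (⟨t, α⟩ : ℂ).im ∈ Ioo L R :=
    ⟨ht, hS.mem_Ioo⟩
  have hF := isComponentOf_connectedComponentIn (hσ_mem (h_mem (sub_one_lt T)))
  refine ⟨_, hF, mem_closure_of_tendsto (h_tendsto α) ((eventually_lt_atBot T).mono fun t ht => ?_)⟩
  refine hF.subset_of_isPreconnected
    (h_conv.isPreconnected.image σ (hσ.mono fun w hw => hw.1)) ?_
    (mem_image_of_mem σ (h_mem (sub_one_lt T)))
    (mem_connectedComponentIn (hσ_mem (h_mem (sub_one_lt T)))) (mem_image_of_mem σ (h_mem ht))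
  exact image_subset_iff.2 fun w hw => hσ_mem hw

theorem exists_ray_of_isComponentOf_openEdges (hp : IsCoveringMapOn p Bᶜ) {e : Set X}
    (he : IsComponentOf (p ⁻¹' G.openEdges) e) :
    ∃ (j : Fin G.q) (U : C(ℝ, X)) (v : X), (∀ t, U t ∈ e) ∧
      (∀ᶠ t in atBot, p (U t) = G.pt ⟨t, G.β j⟩) ∧ p v = G.cross ∧ Tendsto U atBot (𝓝 v) := by
  obtain ⟨u, hu⟩ := he.nonempty
  obtain ⟨j, _, ⟨r, hr, rfl⟩, hru⟩ := mem_iUnion.1 (he.subset hu)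
  rw [h_coe_real_mul_exp _ hr, ← Complex.mk_eq_add_mul_I] at hru
  have h_edge (t : ℝ) : G.pt ⟨t, G.β j⟩ ∈ G.openEdges :=
    G.pt_mem_openEdges_iff.2 (G.β_mem_edgeAngles j)
  obtain ⟨U, v, -, hUe, hpU, hv, h_tendsto⟩ := exists_ray_lift_mem hp he hru.symm hu
    (fun t _ => G.notMem_base_of_mem_openEdges (h_edge t)) h_edge
  refine ⟨j, U, v, hUe, (eventually_le_atBot (Real.log r)).mono fun t ht => ?_, hv, h_tendsto⟩
  rw [hpU, min_eq_left ht]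

namespace IsFaceOver

theorem notMem_graph (hF : G.IsFaceOver p b F) (hu : u ∈ F) : p u ∉ G.graph :=
  connectedComponentIn_subset _ _ (hF.subset hu)

theorem mem_frontier_of_mem_closure (hF : G.IsFaceOver p b F) (hv : p v ∈ G.graph)
    (hvF : v ∈ closure F) : v ∈ frontier F :=
  ⟨hvF, fun h => hF.notMem_graph (interior_subset h) hv⟩

theorem exists_mem_of_mem_closure (hS : G.IsSector L α R) (hF : G.IsFaceOver p (G.pt ⟨0, α⟩) F)
    (hp : IsLocalHomeomorph p) (hv : p v = G.cross) (hvF : v ∈ closure F) {W : Set X}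
    (hW : W ∈ 𝓝 v) : ∀ᶠ t in atBot, ∃ u ∈ W ∩ F, p u = G.pt ⟨t, α⟩ := by
  obtain ⟨T, σ, hσ, hpσ, hσ_near, -⟩ := exists_section_cross hp hv hW
  obtain ⟨u, huσ, huF⟩ := mem_closure_iff_nhds.1 hvF _ hσ_near
  have h_conv : Convex ℝ {w : ℂ | w.re < T ∧ w.im ∈ Ioo L R} :=
    (convex_halfSpace_re_lt T).inter ((convex_halfSpace_im_gt L).inter (convex_halfSpace_im_lt R))
  have huΩ := hF.subset huF
  rw [mem_preimage, hS.connectedComponentIn_eq] at huΩ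
  obtain ⟨w, hw, hwu⟩ := huΩ
  obtain ⟨hwT, hσw⟩ := huσ w hwu.symm
  have hσF : σ '' {w : ℂ | w.re < T ∧ w.im ∈ Ioo L R} ⊆ F := by
    refine hF.subset_of_isPreconnected (h_conv.isPreconnected.image σ (hσ.mono fun w hw => hw.1))
      ?_ ⟨w, ⟨hwT, hw⟩, hσw⟩ huF
    rintro _ ⟨z, hz, rfl⟩
    rw [mem_preimage, (hpσ z hz.1).2, hS.connectedComponentIn_eq]
    exact ⟨z, hz.2, rfl⟩
  filter_upwards [eventually_lt_atBot T] with t ht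
  obtain ⟨hσW, hpσt⟩ := hpσ ⟨t, α⟩ ht
  exact ⟨_, ⟨hσW, hσF ⟨_, ⟨ht, hS.mem_Ioo⟩, rfl⟩⟩, hpσt⟩

theorem eq_of_mem_closure (hF : G.IsFaceOver p b F) (hF' : G.IsFaceOver p b F')
    (hp : IsLocalHomeomorph p) (hb : b ∈ B) (hv : p v = G.cross) (hvF : v ∈ closure F)
    (hvF' : v ∈ closure F') : F = F' := by
  obtain ⟨L, α, R, hS, rfl⟩ := G.exists_isSector hb
  obtain ⟨W, hW, h_inj⟩ := isLocallyInjective_iff_nhds.1 hp.isLocallyInjective v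
  obtain ⟨t, ⟨u, ⟨huW, huF⟩, hu⟩, ⟨u', ⟨huW', huF'⟩, hu'⟩⟩ :=
    ((hF.exists_mem_of_mem_closure hS hp hv hvF hW).and
      (hF'.exists_mem_of_mem_closure hS hp hv hvF' hW)).exists
  obtain rfl : u = u' := h_inj huW huW' (hu.trans hu'.symm)
  exact IsComponentOf.eq_of_mem_of_mem hF hF' huF huF'

theorem cross_unique [T2Space X] (hF : G.IsFaceOver p b F) (hp : IsLocalHomeomorph p)
    (hb : b ∈ B) (h_inj : InjOn p F) {v' : X} (hv : p v = G.cross) (hv' : p v' = G.cross)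
    (hvF : v ∈ closure F) (hvF' : v' ∈ closure F) : v = v' := by
  obtain ⟨L, α, R, hS, rfl⟩ := G.exists_isSector hb
  by_contra hne
  obtain ⟨W, W', hW, hW', hvW, hvW', h_disj⟩ := t2_separation hne
  obtain ⟨t, ⟨u, ⟨huW, huF⟩, hu⟩, ⟨u', ⟨huW', huF'⟩, hu'⟩⟩ :=
    ((hF.exists_mem_of_mem_closure hS hp hv hvF (hW.mem_nhds hvW)).and
      (hF.exists_mem_of_mem_closure hS hp hv' hvF' (hW'.mem_nhds hvW'))).exists
  obtain rfl : u = u' := h_inj huF huF' (hu.trans hu'.symm)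
  exact disjoint_left.1 h_disj huW huW'

theorem exists_ray_to_cross (hS : G.IsSector L α R) (hF : G.IsFaceOver p (G.pt ⟨0, α⟩) F)
    (hp : IsCoveringMapOn p Bᶜ) (ht₀ : t₀ < 0) (huF : u ∈ F) (hu : p u = G.pt ⟨t₀, α⟩) :
    ∃ (U : C(ℝ, X)) (v : X), U t₀ = u ∧ (∀ t, p (U t) = G.pt ⟨min t t₀, α⟩) ∧
      Tendsto U atBot (𝓝 v) ∧ p v = G.cross ∧ v ∈ frontier F := by
  obtain ⟨U, v, hU, hUF, hpU, hv, h_tendsto⟩ := exists_ray_lift_mem hp hF hu huF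
    (fun t ht => hS.pt_notMem_base (ht.trans_lt ht₀).ne) hS.pt_mem_connectedComponentIn
  exact ⟨U, v, hU, hpU, h_tendsto, hv, hF.mem_frontier_of_mem_closure (.inl (.inl hv))
    (mem_closure_of_tendsto h_tendsto (.of_forall hUF))⟩

theorem finite_fibre [T2Space X] (hS : G.IsSector L α R) (hF : G.IsFaceOver p (G.pt ⟨0, α⟩) F)
    (hp : IsLocalHomeomorph p) (hp' : IsCoveringMapOn p Bᶜ)
    (h_fin : (p ⁻¹' {G.cross} ∩ frontier F).Finite) (ht₀ : t₀ < 0) :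
    {u ∈ F | p u = G.pt ⟨t₀, α⟩}.Finite := by
  choose U v hU hpU h_tendsto hv hvF using
    fun u : {u ∈ F | p u = G.pt ⟨t₀, α⟩} => hF.exists_ray_to_cross hS hp' ht₀ u.2.1 u.2.2
  have h_inj : Function.Injective v := fun u u' h => by
    have hp_eq (t : ℝ) : p (U u t) = p (U u' t) := by rw [hpU, hpU]
    obtain ⟨t, ht⟩ := (eventually_eq_of_tendsto hp.isLocallyInjective (h_tendsto u)
      (h ▸ h_tendsto u') (.of_forall hp_eq)).exists
    have hU_eq := eq_of_lifts_eq hp (U u).continuous (U u').continuous hp_eq ht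
    exact Subtype.ext (by rw [← hU u, ← hU u', hU_eq])
  have := h_fin.to_subtype
  exact .of_injective (fun u => (⟨v u, hv u, hvF u⟩ : (p ⁻¹' {G.cross} ∩ frontier F : Set X)))
    fun u u' h => h_inj (congrArg Subtype.val h)

theorem exists_map_eq_label [T2Space X] (hF : G.IsFaceOver p b F) (hp : IsLocalHomeomorph p)
    (hp' : IsCoveringMapOn p Bᶜ) (φ : ℂ ≃ₜ X) (hb : b ∈ B)
    (h_inf : (p ⁻¹' {G.cross, G.circ}).Infinite)
    (h_fin : (p ⁻¹' {G.cross} ∩ frontier F).Finite) : ∃ x ∈ F, p x = b := by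
  obtain ⟨L, α, R, hS, rfl⟩ := G.exists_isSector hb
  by_contra! h_ne
  obtain ⟨e, he, het, he_range⟩ := hS.exists_chart
  have he_zero : e 0 = G.pt ⟨0, α⟩ := by simpa using het 0
  have h_fibre := hF.finite_fibre hS hp hp' h_fin neg_one_lt_zero
  rw [← het] at h_fibre
  obtain ⟨K, hK, hKF⟩ := exists_isCompact_compl_subset hp φ he
    (hp'.mono (by rw [he_range, he_zero]; exact hS.connectedComponentIn_diff_subset))
    (by rwa [he_range]) (by rwa [he_zero]) one_pos h_fibre
  refine h_inf ((finite_inter_preimage_of_isCompact hp (toFinite _) hK).subset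
    fun v hv => ⟨?_, hv⟩)
  by_contra hvK
  exact hF.notMem_graph (hKF hvK).1 (.inl hv)

theorem bijOn [T2Space X] (hF : G.IsFaceOver p b F) (hp : IsLocalHomeomorph p)
    (hp' : IsCoveringMapOn p Bᶜ) (hb : b ∈ B) (hxF : x ∈ F) (hx : p x = b) :
    BijOn p F (connectedComponentIn G.graphᶜ b) := by
  obtain ⟨L, α, R, hS, rfl⟩ := G.exists_isSector hb
  obtain ⟨e, he, het, he_range⟩ := hS.exists_chart
  have he_zero : e 0 = G.pt ⟨0, α⟩ := by simpa using het 0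
  obtain ⟨σ, hσ, hpσ, rfl⟩ := exists_section_disc hp he
    (hp'.mono (by rw [he_range, he_zero]; exact hS.connectedComponentIn_diff_subset))
    (hx.trans he_zero.symm)
  have hFσ : F = range σ := by
    rw [IsComponentOf.eq_of_mem hF hxF, ← he_range,
      connectedComponentIn_eq_range_section hp he hσ hpσ]
  refine ⟨hF.subset, ?_, ?_⟩
  · rw [hFσ]
    rintro _ ⟨w, rfl⟩ _ ⟨w', rfl⟩ h
    rw [hpσ, hpσ] at h
    rw [he.injective h]
  · rw [hFσ, ← he_range]
    rintro _ ⟨w, rfl⟩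
    exact ⟨σ w, mem_range_self w, hpσ w⟩

theorem exists_cross [T2Space X] (hF : G.IsFaceOver p b F) (hp : IsLocalHomeomorph p)
    (hp' : IsCoveringMapOn p Bᶜ) (hb : b ∈ B) (hxF : x ∈ F) (hx : p x = b) :
    ∃ v ∈ frontier F, p v = G.cross := by
  obtain ⟨L, α, R, hS, rfl⟩ := G.exists_isSector hb
  obtain ⟨u, huF, hu⟩ :=
    (hF.bijOn hp hp' hb hxF hx).surjOn (hS.pt_mem_connectedComponentIn (-1))
  obtain ⟨-, v, -, -, -, hv, hvF⟩ := hF.exists_ray_to_cross hS hp' neg_one_lt_zero huF hu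
  exact ⟨v, hvF, hv⟩

theorem finite_edges [T2Space X] (hF : G.IsFaceOver p b F) (hp : IsLocalHomeomorph p)
    (hp' : IsCoveringMapOn p Bᶜ) (hb : b ∈ B) (h_inj : InjOn p F) :
    {e | IsComponentOf (p ⁻¹' G.openEdges) e ∧ e ⊆ frontier F}.Finite := by
  choose j U v hUe hpU hv h_tendsto using
    fun e : {e | IsComponentOf (p ⁻¹' G.openEdges) e ∧ e ⊆ frontier F} =>
      exists_ray_of_isComponentOf_openEdges hp' e.2.1
  have hvF e : v e ∈ closure F := closure_minimal (e.2.2.trans frontier_subset_closure)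
    isClosed_closure (mem_closure_of_tendsto (h_tendsto e) (.of_forall (hUe e)))
  refine .of_injective j fun e e' h => Subtype.ext ?_
  have hvv : v e = v e' := hF.cross_unique hp hb h_inj (hv e) (hv e') (hvF e) (hvF e')
  have hp_eq : ∀ᶠ t in atBot, p (U e t) = p (U e' t) := by
    filter_upwards [hpU e, hpU e'] with t ht ht'
    rw [ht, ht', h]
  obtain ⟨t, ht⟩ := (eventually_eq_of_tendsto hp.isLocallyInjective (h_tendsto e)
    (hvv ▸ h_tendsto e') hp_eq).exists
  exact e.2.1.eq_of_mem_of_mem e'.2.1 (hUe e t) (ht ▸ hUe e' t)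

theorem subsingleton_cross [T2Space X] (hF : G.IsFaceOver p b F) (hp : IsLocalHomeomorph p)
    (hb : b ∈ B) (h_inj : InjOn p F) : (p ⁻¹' {G.cross} ∩ frontier F).Subsingleton :=
  fun _ hv _ hv' => hF.cross_unique hp hb h_inj hv.1 hv'.1 (frontier_subset_closure hv.2)
    (frontier_subset_closure hv'.2)

theorem finite_vertices [T2Space X] (hF : G.IsFaceOver p b F) (hp : IsLocalHomeomorph p)
    (hb : b ∈ B) (h_inj : InjOn p F) : (p ⁻¹' {G.cross, G.circ} ∩ frontier F).Finite := by
  rw [insert_eq, preimage_union, union_inter_distrib_right, ← G.flip_cross]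
  exact (hF.subsingleton_cross hp hb h_inj).finite.union
    ((isFaceOver_flip_iff.2 hF).subsingleton_cross hp hb h_inj).finite

end IsFaceOver

end SymmetricBaseGraph

end Faces

theorem isComponentOf_preimage_iff {X Y : Type*} [TopologicalSpace X] [TopologicalSpace Y]
    {p : X → Y} (hp : Continuous p) {T : Set Y} {y : Y} {F : Set X} :
    IsComponentOf (p ⁻¹' T) F ∧ p '' F ⊆ connectedComponentIn T y ↔
      IsComponentOf (p ⁻¹' connectedComponentIn T y) F := by
  have hT : p ⁻¹' connectedComponentIn T y ⊆ p ⁻¹' T :=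
    preimage_mono (connectedComponentIn_subset T y)
  constructor
  · rintro ⟨hF, hFy⟩
    obtain ⟨x, hx⟩ := hF.nonempty
    have hxy : x ∈ p ⁻¹' connectedComponentIn T y := hFy (mem_image_of_mem p hx)
    refine ⟨x, hxy, (hF.isPreconnected.subset_connectedComponentIn hx
      (image_subset_iff.1 hFy)).antisymm ?_⟩
    exact hF.subset_of_isPreconnected isPreconnected_connectedComponentIn
      ((connectedComponentIn_subset _ _).trans hT) (mem_connectedComponentIn hxy) hx
  · rintro ⟨x, hx, rfl⟩
    have hxT := mem_connectedComponentIn (hT hx)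
    have h_image : p '' connectedComponentIn (p ⁻¹' T) x ⊆ connectedComponentIn T y := by
      rw [connectedComponentIn_eq hx]
      exact (isPreconnected_connectedComponentIn.image p
        hp.continuousOn).subset_connectedComponentIn (mem_image_of_mem p hxT)
        (image_subset_iff.2 (connectedComponentIn_subset _ _))
    have h_eq : connectedComponentIn (p ⁻¹' connectedComponentIn T y) x =
        connectedComponentIn (p ⁻¹' T) x :=
      (connectedComponentIn_mono _ hT).antisymm
        (isPreconnected_connectedComponentIn.subset_connectedComponentIn hxT
          (image_subset_iff.1 h_image))
    exact h_eq ▸ ⟨⟨x, hT hx, rfl⟩, h_image⟩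

section SymmetricFaces

variable {X : Type*} [TopologicalSpace X] {p : X → Sphere} {B : Set Sphere}
  {G : SymmetricBaseGraph B} {b : Sphere} {s : X ≃ₜ X} {F : Set X} {v x : X}

namespace SymmetricBaseGraph

theorem IsFaceOver.image_involution (hF : G.IsFaceOver p b F) (hsp : ∀ x, p (s x) = conj (p x))
    (hb : b ∈ B) (hb_conj : conj b = b) : G.IsFaceOver p b (s '' F) := by
  have h_preimage : s ⁻¹' (p ⁻¹' connectedComponentIn G.graphᶜ b) =
      p ⁻¹' connectedComponentIn G.graphᶜ b := by
    ext x
    rw [mem_preimage, mem_preimage, hsp, mem_preimage]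
    nth_rewrite 1 [← G.image_conj_connectedComponentIn hb hb_conj]
    exact conjHomeo.injective.mem_set_image
  have h := IsComponentOf.image_homeomorph s hF
  nth_rewrite 1 [← h_preimage] at h
  rwa [image_preimage_eq _ s.surjective] at h

theorem IsFaceOver.cross_fixed_of_finite [T2Space X] (hF : G.IsFaceOver p b F)
    (hp : IsLocalHomeomorph p) (hp' : IsCoveringMapOn p Bᶜ) (φ : ℂ ≃ₜ X)
    (hsp : ∀ x, p (s x) = conj (p x)) (hb : b ∈ B) (hb_conj : conj b = b)
    (h_fixed : ∀ x, p x = b → s x = x) (h_inf : (p ⁻¹' {G.cross, G.circ}).Infinite)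
    (h_fin : (p ⁻¹' {G.cross, G.circ} ∩ frontier F).Finite) (hv : p v = G.cross)
    (hvF : v ∈ closure F) : s v = v := by
  have h_fin_cross : (p ⁻¹' {G.cross} ∩ frontier F).Finite :=
    h_fin.subset (inter_subset_inter_left _ (preimage_mono (by simp)))
  obtain ⟨x, hxF, hx⟩ := hF.exists_map_eq_label hp hp' φ hb h_inf h_fin_cross
  have hsF : s '' F = F := IsComponentOf.eq_of_mem_of_mem (hF.image_involution hsp hb hb_conj) hF
    ⟨x, hxF, h_fixed x hx⟩ hxF
  refine hF.cross_unique hp hb (hF.bijOn hp hp' hb hxF hx).injOn ?_ hv ?_ hvF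
  · rw [hsp, hv, G.conj_cross]
  · rw [← hsF, ← s.image_closure]
    exact mem_image_of_mem s hvF

theorem fixed_or_exists_infinite_face [T2Space X] (hp : IsLocalHomeomorph p)
    (hp' : IsCoveringMapOn p Bᶜ) (φ : ℂ ≃ₜ X) (hsp : ∀ x, p (s x) = conj (p x)) (hb : b ∈ B)
    (hb_conj : conj b = b) (h_fixed : ∀ x, p x = b → s x = x)
    (h_inf : (p ⁻¹' {G.cross, G.circ}).Infinite) (hv : p v ∈ ({G.cross, G.circ} : Set Sphere)) :
    s v = v ∨ ∃ F, G.IsFaceOver p b F ∧ v ∈ frontier F ∧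
      (p ⁻¹' {G.cross, G.circ} ∩ frontier F).Infinite := by
  wlog hv_cross : p v = G.cross generalizing G
  · have hv_circ : p v = G.circ := hv.resolve_left hv_cross
    have h_flip : ({G.flip.cross, G.flip.circ} : Set Sphere) = {G.cross, G.circ} := by
      rw [flip_cross, flip_circ, pair_comm]
    simpa only [h_flip, isFaceOver_flip_iff] using this (G := G.flip) (by rwa [h_flip])
      (by rwa [h_flip]) (hv_circ.trans G.flip_cross.symm)
  obtain ⟨F, hF, hvF⟩ := exists_isFaceOver hp hb hv_cross
  by_cases h_fin : (p ⁻¹' {G.cross, G.circ} ∩ frontier F).Finite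
  · exact .inl (hF.cross_fixed_of_finite hp hp' φ hsp hb hb_conj h_fixed h_inf h_fin hv_cross hvF)
  · exact .inr ⟨F, hF, hF.mem_frontier_of_mem_closure (.inl hv) hvF, h_fin⟩

theorem IsFaceOver.label_fixed_of_cross_fixed [T2Space X] (hF : G.IsFaceOver p b F)
    (hp : IsLocalHomeomorph p) (hp' : IsCoveringMapOn p Bᶜ) (hsp : ∀ x, p (s x) = conj (p x))
    (hb : b ∈ B) (hb_conj : conj b = b) (hv : p v = G.cross) (hvF : v ∈ closure F)
    (h_fixed : s v = v) (hxF : x ∈ F) (hx : p x = b) : s x = x := by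
  have hsF : s '' F = F := (hF.image_involution hsp hb hb_conj).eq_of_mem_closure hF hp hb hv
    (s.image_closure F ▸ ⟨v, hvF, h_fixed⟩) hvF
  exact (hF.bijOn hp hp' hb hxF hx).injOn (hsF ▸ mem_image_of_mem s hxF) hxF
    (by rw [hsp, hx, hb_conj])

end SymmetricBaseGraph

end SymmetricFaces

namespace SymmetricSpeiserGraph

variable {X : Type*} [TopologicalSpace X] {A : Set Sphere} {π : X → Sphere} {s : X → X}
  {D : DiscSystem A} (S : SymmetricSpeiserGraph π s D) {b : Sphere}

theorem infinite_vertices (h : S.logEnds.Nonempty) : S.vertices.Infinite := by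
  obtain ⟨_, h_max⟩ := h
  obtain ⟨u, hu, -⟩ := h_max.prop
  have := Infinite.of_injective u hu
  exact infinite_coe_iff.1 this

theorem isFace_and_hasLabel_iff (h_map : Continuous S.deformation.map)
    (hb : b ∈ S.deformation.base) {F : Set X} :
    S.IsFace F ∧ S.HasLabel F b ↔ S.baseGraph.IsFaceOver S.deformation.map b F := by
  rw [SymmetricBaseGraph.IsFaceOver, ← isComponentOf_preimage_iff h_map]
  exact and_congr_right fun _ => and_iff_right hb

theorem isBounded_of_mem [T2Space X] (hp : IsLocalHomeomorph S.deformation.map)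
    (hp' : IsCoveringMapOn S.deformation.map S.deformation.baseᶜ) (hb : b ∈ S.deformation.base)
    {F : Set X} (hF : S.baseGraph.IsFaceOver S.deformation.map b F) {x : X} (hxF : x ∈ F)
    (hx : S.deformation.map x = b) : S.IsBounded F :=
  have h_inj := (hF.bijOn hp hp' hb hxF hx).injOn
  ⟨hF.finite_edges hp hp' hb h_inj, hF.finite_vertices hp hb h_inj⟩

theorem mem_axis_or_mem_frontier_of_preimage_fixed (hX : IsSymmetricNSurface A π s) {φ : ℂ ≃ₜ X}
    (hφ : ∀ z, φ (starRingEnd ℂ z) = s (φ z)) (h_inf : S.vertices.Infinite)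
    (hb : b ∈ S.deformation.base) (hb_conj : conj b = b)
    (h_fixed : ∀ x, S.deformation.map x = b → x ∈ axis s) {v : X} (hv : v ∈ S.vertices) :
    v ∈ axis s ∨ ∃ F, S.IsFace F ∧ ¬ S.IsBounded F ∧ S.HasLabel F b ∧ v ∈ frontier F := by
  have := hX.t2Space
  have hp := S.deformation.isLocalHomeomorph_map hX hφ
  obtain ⟨Q, hQ, hQ_inf⟩ := S.deformation.exists_infinite_preimage hX hφ (toFinite _) h_inf
  have hp' := S.deformation.isCoveringMapOn_map hX hφ hQ hQ_inf
  refine (SymmetricBaseGraph.fixed_or_exists_infinite_face (s := hX.involution) hp hp' φ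
    (S.deformation.map_involution hX hφ) hb hb_conj h_fixed h_inf hv).imp id ?_
  rintro ⟨F, hF, hvF, hF_inf⟩
  obtain ⟨h_face, h_label⟩ := (S.isFace_and_hasLabel_iff hp.continuous hb).2 hF
  exact ⟨F, h_face, fun h => hF_inf h.2, h_label, hvF⟩

theorem mem_axis_of_vertices (hX : IsSymmetricNSurface A π s) {φ : ℂ ≃ₜ X}
    (hφ : ∀ z, φ (starRingEnd ℂ z) = s (φ z)) (h_inf : S.vertices.Infinite)
    (hb : b ∈ S.deformation.base) (hb_conj : conj b = b)
    (h_vertices : ∀ v ∈ S.vertices, v ∈ axis s ∨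
      ∃ F, S.IsFace F ∧ ¬ S.IsBounded F ∧ S.HasLabel F b ∧ v ∈ frontier F)
    {x : X} (hx : S.deformation.map x = b) : x ∈ axis s := by
  have := hX.t2Space
  have hp := S.deformation.isLocalHomeomorph_map hX hφ
  obtain ⟨Q, hQ, hQ_inf⟩ := S.deformation.exists_infinite_preimage hX hφ (toFinite _) h_inf
  have hp' := S.deformation.isCoveringMapOn_map hX hφ hQ hQ_inf
  have hxΩ : x ∈ S.deformation.map ⁻¹' connectedComponentIn S.baseGraph.graphᶜ b := by
    rw [mem_preimage, hx]
    exact mem_connectedComponentIn (S.baseGraph.base_subset_compl_graph hb)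
  have hF : S.baseGraph.IsFaceOver S.deformation.map b _ := isComponentOf_connectedComponentIn hxΩ
  have hxF := mem_connectedComponentIn hxΩ
  obtain ⟨v, hvF, hv⟩ := hF.exists_cross hp hp' hb hxF hx
  rcases h_vertices v (.inl hv) with h_fixed | ⟨F', h_face, h_unbounded, h_label, hvF'⟩
  · exact hF.label_fixed_of_cross_fixed (s := hX.involution) hp hp'
      (S.deformation.map_involution hX hφ) hb hb_conj hv (frontier_subset_closure hvF) h_fixed
      hxF hx
  · have hF' := (S.isFace_and_hasLabel_iff hp.continuous hb).1 ⟨h_face, h_label⟩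
    have hFF' := hF.eq_of_mem_closure hF' hp hb hv (frontier_subset_closure hvF)
      (frontier_subset_closure hvF')
    exact absurd (hFF' ▸ S.isBounded_of_mem hp hp' hb hF hxF hx) h_unbounded

end SymmetricSpeiserGraph

section Zeros

theorem toSphere_eq_zero_iff {f : ℂ → ℂ} {z : ℂ} (hf : MeromorphicAt f z)
    (h_cont : ContinuousAt (toSphere f) z) :
    toSphere f z = ((0 : ℂ) : Sphere) ↔ 0 < meromorphicOrderAt f z := by
  have h_finite {w : ℂ} (hw : toSphere f w ≠ ∞) : toSphere f w = (f w : Sphere) :=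
    if_neg fun h => hw (if_pos h)
  by_cases h_pole : meromorphicOrderAt f z < 0
  · rw [toSphere, if_pos h_pole]
    exact iff_of_false (OnePoint.infty_ne_coe _) h_pole.not_gt
  have hz : toSphere f z = (f z : Sphere) := if_neg h_pole
  have h_near : ∀ᶠ w in 𝓝 z, toSphere f w = (f w : Sphere) :=
    (h_cont.eventually_ne (hz ▸ OnePoint.coe_ne_infty _)).mono fun w hw => h_finite hw
  have h_tendsto : Tendsto f (𝓝[≠] z) (𝓝 (f z)) := by
    refine Tendsto.mono_left ?_ nhdsWithin_le_nhds
    rw [OnePoint.isOpenEmbedding_coe.isInducing.tendsto_nhds_iff]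
    exact (hz ▸ h_cont.tendsto).congr' h_near
  rw [hz, OnePoint.coe_injective.eq_iff, ← tendsto_zero_iff_meromorphicOrderAt_pos hf]
  exact ⟨fun h => h ▸ h_tendsto, fun h => tendsto_nhds_unique h_tendsto h⟩

theorem forall_zero_real_iff {X : Type*} [TopologicalSpace X] {π : X → Sphere} {s : X → X}
    {f : ℂ → ℂ} {φ : ℂ ≃ₜ X} (hf : MeromorphicOn f univ) (hπ : Continuous π)
    (hφ : ∀ z, φ (starRingEnd ℂ z) = s (φ z)) (hπφ : ∀ z, π (φ z) = toSphere f z) :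
    (∀ z : ℂ, 0 < meromorphicOrderAt f z → z.im = 0) ↔
      ∀ x, π x = ((0 : ℂ) : Sphere) → x ∈ axis s := by
  have h_cont : Continuous (toSphere f) :=
    (hπ.comp φ.continuous).congr hπφ
  rw [φ.surjective.forall]
  refine forall_congr' fun z => ?_
  rw [hπφ, toSphere_eq_zero_iff (hf z (mem_univ z)) h_cont.continuousAt, mem_axis_iff hφ]

end Zeros

end NSurface

end

theorem proposition3_general {X : Type*} [TopologicalSpace X] {A : Set NSurface.Sphere}
    {π : X → NSurface.Sphere} {s : X → X} (hX : NSurface.IsSymmetricNSurface A π s)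
    {D : NSurface.DiscSystem A} (S : NSurface.SymmetricSpeiserGraph π s D)
    {f : ℂ → ℂ} (hf : NSurface.IsAssociatedFunction π s f)
    (h_inf : S.vertices.Infinite)
    (h_zero : ((0 : ℂ) : NSurface.Sphere) ∈ A)
    (h_label : ((0 : ℂ) : NSurface.Sphere) ∉ S.deformation.moved) :
    (∀ z : ℂ, 0 < meromorphicOrderAt f z → z.im = 0) ↔
      ∀ v ∈ S.vertices, v ∈ NSurface.axis s ∨
        ∃ F, S.IsFace F ∧ ¬ S.IsBounded F ∧ S.HasLabel F ((0 : ℂ) : NSurface.Sphere) ∧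
          v ∈ frontier F := by
  obtain ⟨hf_mero, φ, hφ, hπφ⟩ := hf
  have h_base : ((0 : ℂ) : NSurface.Sphere) ∈ S.deformation.base := .inl ⟨h_zero, h_label⟩
  have h_conj : NSurface.conj ((0 : ℂ) : NSurface.Sphere) = ((0 : ℂ) : NSurface.Sphere) := by simp
  have h_map (x : X) := S.deformation.map_eq_iff_of_notMem_moved hX hφ h_zero h_label (x := x)
  rw [NSurface.forall_zero_real_iff hf_mero hX.isLocalHomeomorph.continuous hφ hπφ]
  constructor
  · exact fun h v => S.mem_axis_or_mem_frontier_of_preimage_fixed hX hφ h_inf h_base h_conj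
      fun x hx => h x ((h_map x).1 hx)
  · exact fun h x hx => S.mem_axis_of_vertices hX hφ h_inf h_base h_conj h ((h_map x).2 hx)

theorem proposition3 {X : Type*} [TopologicalSpace X] (A : Set NSurface.Sphere)
    (π : X → NSurface.Sphere) (s : X → X) (hX : NSurface.IsSymmetricNSurface A π s)
    (D : NSurface.DiscSystem A) (S : NSurface.SymmetricSpeiserGraph π s D)
    (f : ℂ → ℂ) (hf : NSurface.IsAssociatedFunction π s f)
    (h_ends : 3 ≤ S.logEnds.encard)
    (h_zero : ((0 : ℂ) : NSurface.Sphere) ∈ A)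
    (h_real : {p ∈ NSurface.realLogSingularities π s D |
      p.1 ≠ ((0 : ℂ) : NSurface.Sphere)}.Subsingleton)
    (h_label : ((0 : ℂ) : NSurface.Sphere) ∉ S.deformation.moved) :
    (∀ z : ℂ, 0 < meromorphicOrderAt f z → z.im = 0) ↔
      ∀ v ∈ S.vertices, v ∈ NSurface.axis s ∨
        ∃ F, S.IsFace F ∧ ¬ S.IsBounded F ∧ S.HasLabel F ((0 : ℂ) : NSurface.Sphere) ∧
          v ∈ frontier F := by
  have h_nonempty := Set.encard_pos.1 (lt_of_lt_of_le (by norm_num) h_ends)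
  exact proposition3_general hX S hf (S.infinite_vertices h_nonempty) h_zero h_label
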